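/- For $c_1,c_2\ge 0$ let $\mathcal{L}(c_1,c_2)$ be the class of laws on $\mathbb{R}$ of random variables of the form $u(\zeta)$, where $\zeta$ is standard gaussian and $u:\mathbb{R}\to\mathbb{R}$ is twice continuously differentiable with $|u'(x)|\le c_1$ and $|u''(x)|\le c_2$ for all $x\in\mathbb{R}$. For real random variables $W,Z$ let $d_{TV}(W,Z)=\sup_B|\mathbb{P}(W\in B)-\mathbb{P}(Z\in B)|$, the supremum being over all Borel sets $B\subseteq\mathbb{R}$. Let $\|\cdot\|$ denote the Euclidean norm of vectors and the corresponding operator norm of matrices. Let $X=(X_1,\ldots,X_n)$ be a random vector in $\mathbb{R}^n$, let $g\in C^2(\mathbb{R}^n)$ be real-valued, with gradient $\nabla g$ and Hessian $\nabla^2 g$, and put $$\kappa_0=\Bigl(\mathbb{E}\sum_{i=1}^n\Bigl|\frac{\partial g}{\partial x_i}(X)\Bigr|^4\Bigr)^{1/2},\qquad \kappa_1=\bigl(\mathbb{E}\|\nabla g(X)\|^4\bigr)^{1/4},\qquad \kappa_2=\bigl(\mathbb{E}\|\nabla^2 g(X)\|^4\bigr)^{1/4},$$ as elements of $[0,\infty]$.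 Suppose that $W=g(X)$ has a finite fourth moment, let $\sigma^2=\mathrm{Var}(W)$, and let $Z$ be a normal random variable with the same mean and variance as $W$. 1. If $X_1,\ldots,X_n$ are independent and the law of each $X_i$ belongs to $\mathcal{L}(c_1,c_2)$, where $c_1,c_2\in[0,\infty)$, then $$d_{TV}(W,Z)\le\frac{2\sqrt5\,(c_1c_2\kappa_0+c_1^3\kappa_1\kappa_2)}{\sigma^2}.$$ 2. If $X$ is a gaussian random vector with mean $0$ and (possibly singular) covariance matrix $\Sigma$, then $$d_{TV}(W,Z)\le\frac{2\sqrt5\,\|\Sigma\|^{3/2}\kappa_1\kappa_2}{\sigma^2}.$$ The right-hand sides are computed in $[0,\infty]$ with $0\cdot\infty=0$, $0/0=0$ and $a/0=\infty$ for $a>0$; a normal variable of variance $0$ is a constant, so that $d_{TV}(W,Z)=0$ when $\sigma^2=0$. -/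

import Mathlib

open MeasureTheory ProbabilityTheory
open scoped ENNReal NNReal

namespace SecondOrderPoincare

/-- The class `𝓛(c₁, c₂)` of laws on `ℝ` of the random variables `u(Z)`, where `Z` is standard
gaussian and `u` is twice continuously differentiable with `|u'| ≤ c₁` and `|u''| ≤ c₂`. -/
def gaussianImageClass (c₁ c₂ : ℝ≥0) : Set (Measure ℝ) :=
  {ν | ∃ u : ℝ → ℝ, ContDiff ℝ 2 u ∧ (∀ x, |deriv u x| ≤ c₁) ∧ (∀ x, |deriv (deriv u) x| ≤ c₂) ∧
    ν = (gaussianReal 0 1).map u}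

/-- The total variation distance between two finite measures on `ℝ`:
the supremum of `|μ(B) - ν(B)|` over all Borel sets `B`. -/
noncomputable def tvDist (μ ν : Measure ℝ) : ℝ≥0∞ :=
  ⨆ (B : Set ℝ) (_ : MeasurableSet B), ENNReal.ofReal |μ.real B - ν.real B|

/-- The total variation distance between (the laws of) two real random variables, which may live
on different probability spaces. -/
noncomputable def dTV {Ω Ω' : Type*} [MeasurableSpace Ω] [MeasurableSpace Ω']
    (W : Ω → ℝ) (P : Measure Ω) (Z : Ω' → ℝ) (P' : Measure Ω') : ℝ≥0∞ :=
  tvDist (P.map W) (P'.map Z)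

/-- The partial derivative `∂g/∂xᵢ`. -/
noncomputable def partialDeriv {n : ℕ} (i : Fin n) (g : EuclideanSpace ℝ (Fin n) → ℝ) :
    EuclideanSpace ℝ (Fin n) → ℝ :=
  fun x => fderiv ℝ g x (EuclideanSpace.single i 1)

/-- The Hessian matrix `(∂²g/∂xᵢ∂xⱼ)ᵢⱼ`. -/
noncomputable def hessian {n : ℕ} (g : EuclideanSpace ℝ (Fin n) → ℝ)
    (x : EuclideanSpace ℝ (Fin n)) : Matrix (Fin n) (Fin n) ℝ :=
  Matrix.of fun i j => partialDeriv i (partialDeriv j g) x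

/-- The operator norm of a square real matrix with respect to the Euclidean norm. -/
noncomputable def opNorm {n : ℕ} (A : Matrix (Fin n) (Fin n) ℝ) : ℝ≥0∞ :=
  ‖Matrix.toEuclideanCLM (n := Fin n) (𝕜 := ℝ) A‖ₑ

/-- `κ₀ = (𝔼 ∑ᵢ |∂g/∂xᵢ(X)|⁴)^(1/2)`, an element of `[0, ∞]`. -/
noncomputable def kappa0 {n : ℕ} {Ω : Type*} [MeasurableSpace Ω] (P : Measure Ω)
    (X : Ω → EuclideanSpace ℝ (Fin n)) (g : EuclideanSpace ℝ (Fin n) → ℝ) : ℝ≥0∞ :=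
  (∫⁻ ω, ∑ i, ‖partialDeriv i g (X ω)‖ₑ ^ 4 ∂P) ^ (1 / 2 : ℝ)

/-- `κ₁ = (𝔼 ‖∇g(X)‖⁴)^(1/4)`, an element of `[0, ∞]`. -/
noncomputable def kappa1 {n : ℕ} {Ω : Type*} [MeasurableSpace Ω] (P : Measure Ω)
    (X : Ω → EuclideanSpace ℝ (Fin n)) (g : EuclideanSpace ℝ (Fin n) → ℝ) : ℝ≥0∞ :=
  (∫⁻ ω, ‖gradient g (X ω)‖ₑ ^ 4 ∂P) ^ (1 / 4 : ℝ)

/-- `κ₂ = (𝔼 ‖∇²g(X)‖⁴)^(1/4)`, an element of `[0, ∞]`. -/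
noncomputable def kappa2 {n : ℕ} {Ω : Type*} [MeasurableSpace Ω] (P : Measure Ω)
    (X : Ω → EuclideanSpace ℝ (Fin n)) (g : EuclideanSpace ℝ (Fin n) → ℝ) : ℝ≥0∞ :=
  (∫⁻ ω, opNorm (hessian g (X ω)) ^ 4 ∂P) ^ (1 / 4 : ℝ)

end SecondOrderPoincare

open SecondOrderPoincare

/-! In both cases `X` has the law of `U(x)` with `x` standard gaussian in `ℝⁿ`: `U` acts
coordinatewise by the functions `u i`, or is the matrix `√Σ`. So it suffices to treat `G = g ∘ U`,
with mean `m` and variance `v`.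

For an independent copy `x'` and `y = cos θ • x + sin θ • x'`, differentiating `𝔼 F(x) G(y)` in `θ`
and integrating by parts gives `Cov(F, G) = ∫ sin θ 𝔼⟨∇F(x), ∇G(y)⟩ dθ` over `[0, π/2]`
(`covariance_formula`). Since `sin θ dθ` is a probability measure there and `y` has the law of `x`,
the case `F = G` yields the Poincaré inequality.

Put `T = ⟨∇G(x), ∇G(y)⟩` with `θ` random; then `v = 𝔼 T`. Let `f` solve Stein's equation for a test
function `h`, with `|f'| ≤ 2` (`exists_stein_solution`), and let `w = (G - m) / √v`. The covariance
formula with `F = f ∘ w` gives `v (𝔼 h(G) - 𝔼 h(Z)) = 𝔼 f'(w) 𝔼 T - 𝔼[f'(w) T]`, which is at most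
twice the largest standard deviation of `T` at fixed `θ`. The Poincaré inequality in `(x, x')`
bounds that deviation by `2K`, where `K` bounds the `L²` norm of `∇²G(U)∇G(V)` for standard gaussian
`U`, `V` (`variance_gradPairing_le`). The distance is thus at most `4K / v`, and `4 ≤ 2√5`.

Finally the chain rule and the Cauchy–Schwarz inequality bound `K` by `c₁c₂κ₀ + c₁³κ₁κ₂`,
respectively by `‖Σ‖^(3/2) κ₁κ₂`. Infinite or vanishing factors need separate care because of the
convention `0 · ∞ = 0`. -/

namespace SecondOrderPoincare

open Filter Topology

/-! ### Gaussian integration by parts and rotation of gaussian pairs. -/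

section

/-- Integration by parts for the standard gaussian measure on the line. -/
lemma integral_mul_self_gaussianReal {φ φ' : ℝ → ℝ} {C : ℝ} (hφ : ∀ x, HasDerivAt φ (φ' x) x)
    (hφ' : Continuous φ') (hC : ∀ x, ‖φ x‖ ≤ C) (hC' : ∀ x, ‖φ' x‖ ≤ C) :
    ∫ x, x * φ x ∂(gaussianReal 0 1) = ∫ x, φ' x ∂(gaussianReal 0 1) := by
  have hφc : Continuous φ := continuous_iff_continuousAt.2 fun x => (hφ x).continuousAt
  rw [integral_gaussianReal_eq_integral_smul one_ne_zero,
    integral_gaussianReal_eq_integral_smul one_ne_zero]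
  have hd : ∀ x, HasDerivAt (gaussianPDFReal 0 1) (-x * gaussianPDFReal 0 1 x) x := by
    intro x
    rw [gaussianPDFReal_def]
    have h1 : HasDerivAt (fun x : ℝ => -(x - 0) ^ 2 / (2 * ((1 : ℝ≥0) : ℝ))) (-x) x := by
      have := (((hasDerivAt_id x).sub_const 0).pow 2).neg.div_const (2 * ((1 : ℝ≥0) : ℝ))
      refine this.congr_deriv ?_
      simp only [id, NNReal.coe_one]
      ring
    refine (h1.exp.const_mul _).congr_deriv ?_
    ring
  have hi0 : Integrable (gaussianPDFReal 0 1) := integrable_gaussianPDFReal 0 1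
  have hi1 : Integrable (fun x => x * gaussianPDFReal 0 1 x) := by
    have h : Integrable (fun x : ℝ => x) (gaussianReal 0 1) :=
      (memLp_id_gaussianReal 1).integrable le_rfl
    rw [gaussianReal_of_var_ne_zero _ one_ne_zero] at h
    have := (integrable_withDensity_iff_integrable_smul₀'
      (measurable_gaussianPDF 0 1).aemeasurable (ae_of_all _ fun x => gaussianPDF_lt_top)).1 h
    refine this.congr (ae_of_all _ fun x => ?_)
    simp [mul_comm]
  -- The standard density `ρ` satisfies `ρ' = -x ρ`, so this is integration by parts of `φ` against
  -- `ρ`.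
  have key := integral_mul_deriv_eq_deriv_mul_of_integrable (u := φ) (v := gaussianPDFReal 0 1)
    (u' := φ') (v' := fun x => -x * gaussianPDFReal 0 1 x) (fun x _ => hφ x) (fun x _ => hd x)
    ?_ ?_ ?_
  · calc _ = - ∫ x, φ x * (-x * gaussianPDFReal 0 1 x) := by
          rw [← integral_neg]; congr 1; ext x; simp; ring
      _ = _ := by rw [key, neg_neg]; congr 1; ext x; simp [mul_comm]
  · refine (Integrable.bdd_mul (c := C) hi1.neg hφc.aestronglyMeasurable
      (ae_of_all _ fun x => hC x)).congr (ae_of_all _ fun x => ?_)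
    simp
  · exact Integrable.bdd_mul (c := C) hi0 hφ'.aestronglyMeasurable (ae_of_all _ fun x => hC' x)
  · exact Integrable.bdd_mul (c := C) hi0 hφc.aestronglyMeasurable (ae_of_all _ fun x => hC x)

variable {ι : Type*} [Fintype ι]

/-- The standard gaussian measure on `ι → ℝ`. -/
noncomputable abbrev gaussPi (ι : Type*) [Fintype ι] : Measure (ι → ℝ) :=
  Measure.pi fun _ => gaussianReal 0 1

instance isGaussian_gaussPi : IsGaussian (gaussPi ι) := by
  have h : gaussPi ι = (stdGaussian (EuclideanSpace ℝ ι)).map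
      (EuclideanSpace.equiv ι ℝ).toContinuousLinearMap := by
    rw [← map_pi_eq_stdGaussian, Measure.map_map (by fun_prop) (by fun_prop)]
    exact Measure.map_id.symm
  rw [h]
  infer_instance

lemma integral_id_gaussPi : (gaussPi ι)[id] = 0 := by
  ext i
  have h := (ContinuousLinearMap.proj (R := ℝ) (φ := fun _ : ι => ℝ) i).integral_comp_comm
    (IsGaussian.integrable_id (μ := gaussPi ι))
  simp only [ContinuousLinearMap.proj_apply, id] at h ⊢
  rw [← h]
  have := integral_comp_eval (μ := fun _ : ι => gaussianReal 0 1) (i := i) (f := fun x : ℝ => x)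
    aestronglyMeasurable_id
  simpa using this

/-- Rotation invariance of a gaussian product requires the factor to be centred, which is checked on
every continuous linear functional. -/
lemma measurePreserving_rotation (θ : ℝ) :
    MeasurePreserving (ContinuousLinearMap.rotation (E := ι → ℝ) θ)
      ((gaussPi ι).prod (gaussPi ι)) ((gaussPi ι).prod (gaussPi ι)) := by
  refine ⟨by fun_prop, IsGaussian.map_rotation_eq_self_of_forall_strongDual_eq_zero
    (fun L => ?_) θ⟩
  have := L.integral_comp_comm (IsGaussian.integrable_id (μ := gaussPi ι))
  simp only [id] at this
  rw [this]
  have h := integral_id_gaussPi (ι := ι)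
  simp only [id] at h
  rw [h, map_zero]

/-- The first component of the rotation of `(x, x')` by the angle `θ`. -/
noncomputable def mix (θ : ℝ) (p : (ι → ℝ) × (ι → ℝ)) : ι → ℝ :=
  Real.cos θ • p.1 + Real.sin θ • p.2

lemma mix_eq_rotation (θ : ℝ) (p : (ι → ℝ) × (ι → ℝ)) :
    mix θ p = (ContinuousLinearMap.rotation θ p).1 := rfl

lemma measurePreserving_mix (θ : ℝ) :
    MeasurePreserving (mix (ι := ι) θ) ((gaussPi ι).prod (gaussPi ι)) (gaussPi ι) :=
  measurePreserving_fst.comp (measurePreserving_rotation θ)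

omit [Fintype ι] in
lemma continuous_mix : Continuous fun q : ℝ × ((ι → ℝ) × (ι → ℝ)) => mix q.1 q.2 := by
  unfold mix
  fun_prop

omit [Fintype ι] in
lemma continuous_mix_right (θ : ℝ) : Continuous (mix (ι := ι) θ) := by
  unfold mix
  fun_prop

omit [Fintype ι] in
lemma continuous_mix_left (p : (ι → ℝ) × (ι → ℝ)) : Continuous fun θ => mix θ p := by
  unfold mix
  fun_prop

/-- Rotating back by `-θ` lets a function of the first vector be rewritten as a function of the
rotated pair. -/
lemma mix_neg_rotation (θ : ℝ) (p : (ι → ℝ) × (ι → ℝ)) :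
    mix (-θ) (ContinuousLinearMap.rotation θ p) = p.1 := by
  ext i
  simp only [mix, ContinuousLinearMap.rotation_apply, Real.cos_neg, Real.sin_neg, Pi.add_apply,
    Pi.smul_apply, smul_eq_mul]
  linear_combination p.1 i * Real.sin_sq_add_cos_sq θ

variable [DecidableEq ι]

/-- The partial derivative of a function on `ι → ℝ`. -/
noncomputable def pd (i : ι) (F : (ι → ℝ) → ℝ) (x : ι → ℝ) : ℝ := fderiv ℝ F x (Pi.single i 1)

lemma continuous_pd {F : (ι → ℝ) → ℝ} (hF : ContDiff ℝ 1 F) (i : ι) : Continuous (pd i F) :=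
  (hF.continuous_fderiv one_ne_zero).clm_apply continuous_const

lemma fderiv_apply_eq_sum_pd (F : (ι → ℝ) → ℝ) (x v : ι → ℝ) :
    fderiv ℝ F x v = ∑ i, v i * pd i F x := by
  conv_lhs => rw [pi_eq_sum_univ' v, map_sum]
  refine Finset.sum_congr rfl fun i _ => ?_
  rw [pd, map_smul, smul_eq_mul]

lemma norm_pd_le {F : (ι → ℝ) → ℝ} {C : ℝ} (x : ι → ℝ) (h : ‖fderiv ℝ F x‖ ≤ C) (i : ι) :
    ‖pd i F x‖ ≤ C := by
  refine ((fderiv ℝ F x).le_opNorm _).trans ?_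
  rw [Pi.norm_single]
  simpa using h

/-- Resampling one coordinate preserves the product law. This singles out a coordinate by Fubini
without splitting the index type; the discarded coordinate contributes a factor of mass one. -/
lemma measurePreserving_update (i : ι) :
    MeasurePreserving (fun p : (ι → ℝ) × ℝ => Function.update p.1 i p.2)
      ((gaussPi ι).prod (gaussianReal 0 1)) (gaussPi ι) := by
  have hm : Measurable (fun p : (ι → ℝ) × ℝ => Function.update p.1 i p.2) := by
    refine measurable_pi_lambda _ fun j => ?_
    by_cases h : j = i
    · subst h; simpa using measurable_snd
    · simp only [Function.update_of_ne h]; fun_prop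
  refine ⟨hm, (Measure.pi_eq fun s hs => ?_).symm⟩
  rw [Measure.map_apply hm (MeasurableSet.univ_pi hs)]
  have : (fun p : (ι → ℝ) × ℝ => Function.update p.1 i p.2) ⁻¹' Set.univ.pi s =
      (Set.univ.pi (Function.update s i Set.univ)) ×ˢ s i := by
    ext ⟨y, z⟩
    simp only [Set.mem_preimage, Set.mem_pi, Set.mem_univ, true_imp_iff, Set.mem_prod]
    constructor
    · intro h
      refine ⟨fun j => ?_, by simpa using h i⟩
      by_cases hj : j = i
      · subst hj; simp
      · simpa [Function.update_of_ne hj] using h j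
    · rintro ⟨h, h'⟩ j
      by_cases hj : j = i
      · subst hj; simpa using h'
      · simpa [Function.update_of_ne hj] using h j
  rw [this, Measure.prod_prod, Measure.pi_pi, ← Finset.mul_prod_erase _ _ (Finset.mem_univ i),
    ← Finset.mul_prod_erase _ (fun j => gaussianReal 0 1 (s j)) (Finset.mem_univ i)]
  simp only [Function.update_self, measure_univ, one_mul]
  rw [mul_comm]
  congr 1
  refine Finset.prod_congr rfl fun j hj => ?_
  rw [Function.update_of_ne (Finset.ne_of_mem_erase hj)]

omit [DecidableEq ι] in
lemma integrable_eval_gaussPi (i : ι) : Integrable (fun x => x i) (gaussPi ι) :=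
  (ContinuousLinearMap.proj (R := ℝ) (φ := fun _ : ι => ℝ) i).integrable_comp
    (IsGaussian.integrable_id (μ := gaussPi ι))

/-- Integration by parts for the standard gaussian measure in one coordinate. -/
lemma integral_eval_mul_gaussPi {Φ : (ι → ℝ) → ℝ} {C : ℝ} (hΦ : ContDiff ℝ 1 Φ)
    (hC : ∀ x, ‖Φ x‖ ≤ C) (hC' : ∀ x, ‖fderiv ℝ Φ x‖ ≤ C) (i : ι) :
    ∫ x, x i * Φ x ∂(gaussPi ι) = ∫ x, pd i Φ x ∂(gaussPi ι) := by
  have hpd := continuous_pd hΦ i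
  have h1 : Integrable (fun x => x i * Φ x) (gaussPi ι) :=
    (integrable_eval_gaussPi i).mul_bdd (c := C) hΦ.continuous.aestronglyMeasurable (ae_of_all _ hC)
  have h2 : Integrable (pd i Φ) (gaussPi ι) :=
    .of_bound hpd.aestronglyMeasurable C (ae_of_all _ fun x => norm_pd_le x (hC' x) i)
  have hmp := measurePreserving_update i
  have hu : ∀ (y : ι → ℝ) (z : ℝ), HasDerivAt (Function.update y i) (Pi.single i 1) z :=
    fun y z => hasDerivAt_update y i z
  rw [← hmp.map_eq] at h1 h2 ⊢
  rw [integral_map hmp.measurable.aemeasurable h1.aestronglyMeasurable,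
    integral_map hmp.measurable.aemeasurable h2.aestronglyMeasurable]
  rw [integrable_map_measure h1.aestronglyMeasurable hmp.measurable.aemeasurable] at h1
  rw [integrable_map_measure h2.aestronglyMeasurable hmp.measurable.aemeasurable] at h2
  refine (integral_prod _ h1).trans (Eq.trans ?_ (integral_prod _ h2).symm)
  congr 1
  ext y
  simp only [Function.comp, Function.update_self]
  refine integral_mul_self_gaussianReal (φ := fun z => Φ (Function.update y i z)) (C := C)
    (fun z => ?_) ?_ (fun z => hC _) (fun z => norm_pd_le _ (hC' _) i)
  · exact ((hΦ.differentiable one_ne_zero _).hasFDerivAt.comp_hasDerivAt z (hu y z))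
  · exact hpd.comp (continuous_const.update i continuous_id)

end

/-! ### The covariance formula for bounded functions, by interpolation along rotations. -/

section

variable {ι : Type*} [Fintype ι] [DecidableEq ι]

lemma pd_comp_affine {Φ : (ι → ℝ) → ℝ} (hΦ : ContDiff ℝ 1 Φ) (a : ι → ℝ) (c : ℝ) (x : ι → ℝ)
    (i : ι) : pd i (fun y => Φ (a + c • y)) x = c * pd i Φ (a + c • x) := by
  have h : HasFDerivAt (fun y : ι → ℝ => a + c • y) (c • ContinuousLinearMap.id ℝ (ι → ℝ)) x :=
    ((hasFDerivAt_id x).const_smul c).const_add a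
  have := (hΦ.differentiable one_ne_zero (a + c • x)).hasFDerivAt.comp x h
  rw [pd]
  erw [this.fderiv]
  simp [pd]

/-- The derivative identity behind the covariance formula: gaussian integration by parts for a
rotated pair of independent standard gaussian vectors. -/
lemma integral_mul_fderiv_rotation {F G : (ι → ℝ) → ℝ} {C : ℝ} (hF : ContDiff ℝ 1 F)
    (hG : ContDiff ℝ 1 G) (hFC : ∀ x, ‖F x‖ ≤ C) (hFC' : ∀ x, ‖fderiv ℝ F x‖ ≤ C)
    (hGC' : ∀ x, ‖fderiv ℝ G x‖ ≤ C) (θ : ℝ) :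
    ∫ p, F p.1 * fderiv ℝ G (mix θ p) (ContinuousLinearMap.rotation θ p).2
        ∂((gaussPi ι).prod (gaussPi ι)) =
      - Real.sin θ * ∫ p, ∑ i, pd i F p.1 * pd i G (mix θ p)
        ∂((gaussPi ι).prod (gaussPi ι)) := by
  have hC : 0 ≤ C := (norm_nonneg _).trans (hFC 0)
  have hrot := measurePreserving_rotation (ι := ι) θ
  have hmix := continuous_mix_right (ι := ι)
  have hmeas {Ψ : (ι → ℝ) × (ι → ℝ) → ℝ} (h : Continuous Ψ) :
      AEStronglyMeasurable Ψ (((gaussPi ι).prod (gaussPi ι)).map (ContinuousLinearMap.rotation θ)) :=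
    h.aestronglyMeasurable
  have hpdF := fun i => continuous_pd hF i
  have hpdG := fun i => continuous_pd hG i
  have hcv {Ψ : (ι → ℝ) × (ι → ℝ) → ℝ} (h : Continuous Ψ) :
      ∫ p, Ψ (ContinuousLinearMap.rotation θ p) ∂((gaussPi ι).prod (gaussPi ι)) =
        ∫ q, Ψ q ∂((gaussPi ι).prod (gaussPi ι)) := by
    rw [← integral_map hrot.measurable.aemeasurable (hmeas h), hrot.map_eq]
  have hsnd : ∀ i, Integrable (fun q : (ι → ℝ) × (ι → ℝ) => q.2 i)
      ((gaussPi ι).prod (gaussPi ι)) := fun i => (integrable_eval_gaussPi i).comp_snd _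
  have hI1 : ∀ i, Integrable (fun q : (ι → ℝ) × (ι → ℝ) =>
      F (mix (-θ) q) * (q.2 i * pd i G q.1)) ((gaussPi ι).prod (gaussPi ι)) := fun i =>
    ((hsnd i).mul_bdd (c := C) ((hpdG i).comp continuous_fst).aestronglyMeasurable
      (ae_of_all _ fun q => norm_pd_le _ (hGC' _) i)).bdd_mul (c := C)
      (hF.continuous.comp (hmix _)).aestronglyMeasurable (ae_of_all _ fun q => hFC _)
  have hI2 : ∀ i, Integrable (fun q : (ι → ℝ) × (ι → ℝ) =>
      pd i F (mix (-θ) q) * pd i G q.1) ((gaussPi ι).prod (gaussPi ι)) := fun i =>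
    .of_bound ((hpdF i).comp (hmix _) |>.mul ((hpdG i).comp continuous_fst)).aestronglyMeasurable
      (C * C) (ae_of_all _ fun q => by
        rw [norm_mul]
        exact mul_le_mul (norm_pd_le _ (hFC' _) i) (norm_pd_le _ (hGC' _) i) (norm_nonneg _) hC)
  calc
    _ = ∫ q : (ι → ℝ) × (ι → ℝ), F (mix (-θ) q) * fderiv ℝ G q.1 q.2
        ∂((gaussPi ι).prod (gaussPi ι)) := by
      -- The rotated pair `q` is again standard and the original first vector is `mix (-θ) q`, so
      -- the direction of differentiation becomes the independent variable `q.2`.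
      have h := hcv (Ψ := fun q => F (mix (-θ) q) * fderiv ℝ G q.1 q.2)
        ((hF.continuous.comp (hmix _)).mul
          (((hG.continuous_fderiv one_ne_zero).comp continuous_fst).clm_apply continuous_snd))
      simp only [mix_neg_rotation] at h
      exact h
    _ = ∑ i, ∫ q : (ι → ℝ) × (ι → ℝ), F (mix (-θ) q) * (q.2 i * pd i G q.1)
        ∂((gaussPi ι).prod (gaussPi ι)) := by
      rw [← integral_finsetSum _ fun i _ => hI1 i]
      simp only [fderiv_apply_eq_sum_pd, Finset.mul_sum]
    _ = ∑ i, - Real.sin θ * ∫ q : (ι → ℝ) × (ι → ℝ), pd i F (mix (-θ) q) * pd i G q.1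
        ∂((gaussPi ι).prod (gaussPi ι)) := by
      refine Finset.sum_congr rfl fun i _ => ?_
      rw [integral_prod _ (hI1 i), integral_prod _ (hI2 i), ← integral_const_mul]
      congr 1
      ext y
      have hc : ContDiff ℝ 1 fun y' => F (Real.cos θ • y + (-Real.sin θ) • y') := by fun_prop
      -- With `y` frozen, integrate by parts in `y'`; the factor `-sin θ` is the coefficient of `y'`
      -- in `mix (-θ) (y, y')`.
      have key := integral_eval_mul_gaussPi (C := C)
        (Φ := fun y' => F (Real.cos θ • y + (-Real.sin θ) • y')) hc (fun _ => hFC _) (fun x => ?_) i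
      · have e1 : ∀ y', mix (-θ) (y, y') = Real.cos θ • y + (-Real.sin θ) • y' := fun y' => by
          simp [mix]
        simp only [e1]
        calc _ = (∫ y', y' i * F (Real.cos θ • y + (-Real.sin θ) • y') ∂(gaussPi ι)) *
                pd i G y := by
              rw [← integral_mul_const]; congr 1; ext y'; ring
          _ = _ := by
              rw [key]
              simp only [pd_comp_affine hF]
              rw [integral_const_mul, integral_mul_const, mul_assoc]
      · have h : HasFDerivAt (fun y' : ι → ℝ => Real.cos θ • y + (-Real.sin θ) • y')
            ((-Real.sin θ) • ContinuousLinearMap.id ℝ (ι → ℝ)) x :=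
          ((hasFDerivAt_id x).const_smul (-Real.sin θ)).const_add _
        have h2 := (hF.differentiable one_ne_zero _).hasFDerivAt.comp x h
        erw [h2.fderiv]
        refine (ContinuousLinearMap.opNorm_comp_le _ _).trans ?_
        have h3 : ‖(-Real.sin θ) • ContinuousLinearMap.id ℝ (ι → ℝ)‖ ≤ 1 := by
          rw [norm_smul, norm_neg]
          exact mul_le_one₀ (Real.abs_sin_le_one θ) (norm_nonneg _) ContinuousLinearMap.norm_id_le
        exact (mul_le_mul (hFC' _) h3 (norm_nonneg _) hC).trans (mul_one C).le
    _ = - Real.sin θ * ∫ q : (ι → ℝ) × (ι → ℝ), ∑ i, pd i F (mix (-θ) q) * pd i G q.1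
        ∂((gaussPi ι).prod (gaussPi ι)) := by
      rw [integral_finsetSum _ fun i _ => hI2 i, Finset.mul_sum]
    _ = _ := by
      have h := hcv (Ψ := fun q => ∑ i, pd i F (mix (-θ) q) * pd i G q.1)
        (continuous_finsetSum _ fun i _ =>
          ((hpdF i).comp (hmix _)).mul ((hpdG i).comp continuous_fst))
      simp only [mix_neg_rotation] at h
      rw [← h]
      rfl

/-- The gaussian covariance formula for bounded functions with bounded derivatives. -/
lemma covariance_formula_of_bounded {F G : (ι → ℝ) → ℝ} {C : ℝ} (hF : ContDiff ℝ 1 F)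
    (hG : ContDiff ℝ 1 G) (hFC : ∀ x, ‖F x‖ ≤ C) (hFC' : ∀ x, ‖fderiv ℝ F x‖ ≤ C)
    (hGC : ∀ x, ‖G x‖ ≤ C) (hGC' : ∀ x, ‖fderiv ℝ G x‖ ≤ C) :
    ∫ x, F x * G x ∂(gaussPi ι) - (∫ x, F x ∂(gaussPi ι)) * ∫ x, G x ∂(gaussPi ι) =
      ∫ θ in (0 : ℝ)..(Real.pi / 2), Real.sin θ * ∫ p, ∑ i, pd i F p.1 * pd i G (mix θ p)
        ∂((gaussPi ι).prod (gaussPi ι)) := by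
  have hC : 0 ≤ C := (norm_nonneg _).trans (hFC 0)
  have hmix := continuous_mix_right (ι := ι)
  have hpdF := fun i => continuous_pd hF i
  have hpdG := fun i => continuous_pd hG i
  have hderiv : ∀ θ : ℝ, HasDerivAt
      (fun θ => ∫ p, F p.1 * G (mix θ p) ∂((gaussPi ι).prod (gaussPi ι)))
      (- Real.sin θ * ∫ p, ∑ i, pd i F p.1 * pd i G (mix θ p)
        ∂((gaussPi ι).prod (gaussPi ι))) θ := by
    intro θ
    rw [← integral_mul_fderiv_rotation hF hG hFC hFC' hGC']
    refine (hasDerivAt_integral_of_dominated_loc_of_deriv_le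
      (F' := fun θ p => F p.1 * fderiv ℝ G (mix θ p) (ContinuousLinearMap.rotation θ p).2)
      (bound := fun p => C * (C * (‖p.1‖ + ‖p.2‖))) univ_mem ?_ ?_ ?_ ?_ ?_ ?_).2
    · exact Eventually.of_forall fun θ => ((hF.continuous.comp continuous_fst).mul
        (hG.continuous.comp (hmix θ))).aestronglyMeasurable
    · refine .of_bound ((hF.continuous.comp continuous_fst).mul
        (hG.continuous.comp (hmix θ))).aestronglyMeasurable (C * C) (ae_of_all _ fun p => ?_)
      rw [norm_mul]
      exact mul_le_mul (hFC _) (hGC _) (norm_nonneg _) hC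
    · exact ((hF.continuous.comp continuous_fst).mul
        (((hG.continuous_fderiv one_ne_zero).comp (hmix θ)).clm_apply
          (continuous_snd.comp (ContinuousLinearMap.continuous _)))).aestronglyMeasurable
    · refine ae_of_all _ fun p θ _ => ?_
      rw [norm_mul]
      refine mul_le_mul (hFC _) (((fderiv ℝ G _).le_opNorm _).trans
        (mul_le_mul (hGC' _) ?_ (norm_nonneg _) hC)) (norm_nonneg _) hC
      rw [ContinuousLinearMap.rotation_apply]
      refine (norm_add_le _ _).trans (add_le_add ?_ ?_) <;> rw [norm_smul]
      · exact mul_le_of_le_one_left (norm_nonneg _) (by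
          rw [norm_neg]; exact Real.abs_sin_le_one θ)
      · exact mul_le_of_le_one_left (norm_nonneg _) (Real.abs_cos_le_one θ)
    · have h := (IsGaussian.integrable_id (μ := gaussPi ι)).norm
      exact (((h.comp_fst _).add (h.comp_snd _)).const_mul C).const_mul C
    · refine ae_of_all _ fun p θ _ => ?_
      have h1 : HasDerivAt (fun θ => mix θ p) (ContinuousLinearMap.rotation θ p).2 θ := by
        rw [ContinuousLinearMap.rotation_apply]
        exact ((Real.hasDerivAt_cos θ).smul_const p.1).add ((Real.hasDerivAt_sin θ).smul_const p.2)
      exact ((hG.differentiable one_ne_zero _).hasFDerivAt.comp_hasDerivAt θ h1).const_mul _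
  have hcont : Continuous fun θ : ℝ => - Real.sin θ * ∫ p, ∑ i, pd i F p.1 * pd i G (mix θ p)
        ∂((gaussPi ι).prod (gaussPi ι)) := by
    refine (Real.continuous_sin.neg).mul ?_
    refine continuous_of_dominated (bound := fun _ => ∑ i : ι, C * C) (fun θ => ?_) (fun θ => ?_)
      (integrable_const _) (ae_of_all _ fun p => ?_)
    · exact (continuous_finsetSum _ fun i _ => ((hpdF i).comp continuous_fst).mul
        ((hpdG i).comp (hmix θ))).aestronglyMeasurable
    · refine ae_of_all _ fun p => (norm_sum_le _ _).trans (Finset.sum_le_sum fun i _ => ?_)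
      rw [norm_mul]
      exact mul_le_mul (norm_pd_le _ (hFC' _) i) (norm_pd_le _ (hGC' _) i) (norm_nonneg _) hC
    · exact continuous_finsetSum _ fun i _ => continuous_const.mul
        ((hpdG i).comp (continuous_mix_left p))
  have hftc := intervalIntegral.integral_eq_sub_of_hasDerivAt (a := 0) (b := Real.pi / 2)
    (fun θ _ => hderiv θ) (hcont.intervalIntegrable _ _)
  have e0 : ∫ p : (ι → ℝ) × (ι → ℝ), F p.1 * G (mix 0 p) ∂((gaussPi ι).prod (gaussPi ι)) =
      ∫ x, F x * G x ∂(gaussPi ι) := by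
    have : ∀ p : (ι → ℝ) × (ι → ℝ), mix 0 p = p.1 := fun p => by simp [mix]
    simp only [this]
    rw [integral_fun_fst (fun x => F x * G x)]
    simp
  have e1 : ∫ p : (ι → ℝ) × (ι → ℝ), F p.1 * G (mix (Real.pi / 2) p)
      ∂((gaussPi ι).prod (gaussPi ι)) = (∫ x, F x ∂(gaussPi ι)) * ∫ x, G x ∂(gaussPi ι) := by
    have : ∀ p : (ι → ℝ) × (ι → ℝ), mix (Real.pi / 2) p = p.2 := fun p => by simp [mix]
    simp only [this]
    rw [integral_prod_mul]
  -- The interpolation runs from `𝔼[F G]` at `θ = 0` to `𝔼 F 𝔼 G` at `θ = π/2`, so the increment is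
  -- minus the covariance.
  rw [e0, e1] at hftc
  rw [← neg_sub, ← hftc, ← intervalIntegral.integral_neg]
  simp

end

/-! ### Random angle, truncation, the general covariance formula and the Poincaré inequality. -/

section

lemma integral_comp_measurePreserving {α β : Type*} [MeasurableSpace α] [MeasurableSpace β]
    {μ : Measure α} {ν : Measure β} {u : α → β} (hu : MeasurePreserving u μ ν) {f : β → ℝ}
    (hf : AEStronglyMeasurable f ν) : ∫ x, f (u x) ∂μ = ∫ y, f y ∂ν := by
  rw [← integral_map hu.measurable.aemeasurable (hu.map_eq.symm ▸ hf), hu.map_eq]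

/-- The probability measure `sin θ dθ` on `[0, π / 2]`. -/
noncomputable def sinMeasure : Measure ℝ :=
  (volume.restrict (Set.Ioc 0 (Real.pi / 2))).withDensity fun θ => ENNReal.ofReal (Real.sin θ)

lemma integral_sinMeasure (f : ℝ → ℝ) :
    ∫ θ, f θ ∂sinMeasure = ∫ θ in (0 : ℝ)..(Real.pi / 2), Real.sin θ * f θ := by
  rw [sinMeasure, integral_withDensity_eq_integral_toReal_smul (by fun_prop)
    (ae_of_all _ fun _ => ENNReal.ofReal_lt_top),
    intervalIntegral.integral_of_le (by positivity)]
  refine setIntegral_congr_fun measurableSet_Ioc fun θ hθ => ?_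
  simp only [smul_eq_mul]
  rw [ENNReal.toReal_ofReal]
  exact Real.sin_nonneg_of_nonneg_of_le_pi hθ.1.le (by linarith [hθ.2, Real.pi_pos])

instance isProbabilityMeasure_sinMeasure : IsProbabilityMeasure sinMeasure := by
  constructor
  rw [sinMeasure, withDensity_apply _ MeasurableSet.univ, Measure.restrict_univ,
    ← ofReal_integral_eq_lintegral_ofReal]
  · rw [← intervalIntegral.integral_of_le (by positivity)]
    simp
  · exact (Real.continuous_sin.integrableOn_Icc).mono_set Set.Ioc_subset_Icc_self
  · refine (ae_restrict_mem measurableSet_Ioc).mono fun θ hθ => ?_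
    exact Real.sin_nonneg_of_nonneg_of_le_pi hθ.1.le (by linarith [hθ.2, Real.pi_pos])

section

variable {ι : Type*} [Fintype ι]

/-- The law of a random angle together with an independent pair of standard gaussian vectors. -/
noncomputable abbrev angleGaussPi (ι : Type*) [Fintype ι] : Measure (ℝ × ((ι → ℝ) × (ι → ℝ))) :=
  sinMeasure.prod ((gaussPi ι).prod (gaussPi ι))

lemma measurePreserving_angle_fst :
    MeasurePreserving (fun q : ℝ × ((ι → ℝ) × (ι → ℝ)) => q.2.1) (angleGaussPi ι) (gaussPi ι) :=
  measurePreserving_fst.comp measurePreserving_snd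

lemma measurePreserving_angle_mix :
    MeasurePreserving (fun q : ℝ × ((ι → ℝ) × (ι → ℝ)) => mix q.1 q.2) (angleGaussPi ι)
      (gaussPi ι) :=
  measurePreserving_snd.comp ((MeasurePreserving.id sinMeasure).skew_product
    (g := fun θ p => mix θ p) continuous_mix.measurable
    (ae_of_all _ fun θ => (measurePreserving_mix θ).map_eq))

/-- A sequence of smooth cutoff functions exhausting the space, with bounded derivatives. -/
lemma exists_cutoff (ι : Type*) [Fintype ι] : ∃ (χ : ℕ → (ι → ℝ) → ℝ) (C : ℝ), 0 ≤ C ∧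
    (∀ k, ContDiff ℝ 1 (χ k)) ∧ (∀ k x, ‖χ k x‖ ≤ 1) ∧ (∀ k, HasCompactSupport (χ k)) ∧
    (∀ k x, ‖fderiv ℝ (χ k) x‖ ≤ C) ∧ ∀ x, ∀ᶠ k in atTop, χ k =ᶠ[𝓝 x] fun _ => 1 := by
  let b : ContDiffBump (0 : ι → ℝ) := ⟨1, 2, one_pos, one_lt_two⟩
  have hb : ContDiff ℝ 1 b := b.contDiff
  obtain ⟨C, hC⟩ := (b.hasCompactSupport.fderiv (𝕜 := ℝ)).exists_bound_of_continuous
    (hb.continuous_fderiv one_ne_zero)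
  have hC0 : 0 ≤ C := (norm_nonneg _).trans (hC 0)
  -- Dilations of one bump function: the factor `1/(k + 1) ≤ 1` keeps the derivatives below the
  -- bound `C` of the bump, uniformly in `k`.
  refine ⟨fun k x => b (((k : ℝ) + 1)⁻¹ • x), C, hC0, fun k => by fun_prop, fun k x => ?_,
    fun k => ?_, fun k x => ?_, fun x => ?_⟩
  · rw [Real.norm_of_nonneg b.nonneg]
    exact b.le_one
  · exact b.hasCompactSupport.comp_smul (by positivity)
  · have h : HasFDerivAt (fun x : ι → ℝ => ((k : ℝ) + 1)⁻¹ • x)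
        (((k : ℝ) + 1)⁻¹ • ContinuousLinearMap.id ℝ (ι → ℝ)) x :=
      (hasFDerivAt_id (𝕜 := ℝ) x).const_smul (((k : ℝ) + 1)⁻¹)
    have h2 := (hb.differentiable one_ne_zero _).hasFDerivAt.comp x h
    have h3 : ‖((k : ℝ) + 1)⁻¹ • ContinuousLinearMap.id ℝ (ι → ℝ)‖ ≤ 1 := by
      rw [norm_smul]
      refine mul_le_one₀ ?_ (norm_nonneg _) ContinuousLinearMap.norm_id_le
      rw [norm_inv, Real.norm_of_nonneg (by positivity)]
      exact inv_le_one_of_one_le₀ (by linarith [k.cast_nonneg (α := ℝ)])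
    erw [h2.fderiv]
    refine (ContinuousLinearMap.opNorm_comp_le _ _).trans ?_
    exact (mul_le_mul (hC _) h3 (norm_nonneg _) hC0).trans (mul_one C).le
  · obtain ⟨N, hN⟩ := exists_nat_gt ‖x‖
    filter_upwards [eventually_ge_atTop N] with k hk
    have hk' : (N : ℝ) ≤ k := by exact_mod_cast hk
    have : ∀ᶠ y in 𝓝 x, ‖y‖ < (k : ℝ) + 1 :=
      (continuous_norm.tendsto x).eventually_lt_const (by linarith)
    filter_upwards [this] with y hy
    refine b.one_of_mem_closedBall ?_
    rw [mem_closedBall_zero_iff, norm_smul, norm_inv, Real.norm_of_nonneg (by positivity),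
      inv_mul_le_iff₀ (by positivity)]
    change ‖y‖ ≤ ((k : ℝ) + 1) * 1
    linarith

end

variable {ι : Type*} [Fintype ι] [DecidableEq ι]

lemma covariance_formula_of_hasCompactSupport {F G : (ι → ℝ) → ℝ} (hF : ContDiff ℝ 1 F)
    (hG : ContDiff ℝ 1 G) (hFs : HasCompactSupport F) (hGs : HasCompactSupport G) :
    ∫ x, F x * G x ∂(gaussPi ι) - (∫ x, F x ∂(gaussPi ι)) * ∫ x, G x ∂(gaussPi ι) =
      ∫ q, ∑ i, pd i F q.2.1 * pd i G (mix q.1 q.2) ∂(angleGaussPi ι) := by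
  obtain ⟨C₁, h₁⟩ := hFs.exists_bound_of_continuous hF.continuous
  obtain ⟨C₂, h₂⟩ := hGs.exists_bound_of_continuous hG.continuous
  obtain ⟨C₃, h₃⟩ := (hFs.fderiv (𝕜 := ℝ)).exists_bound_of_continuous
    (hF.continuous_fderiv one_ne_zero)
  obtain ⟨C₄, h₄⟩ := (hGs.fderiv (𝕜 := ℝ)).exists_bound_of_continuous
    (hG.continuous_fderiv one_ne_zero)
  set C := max (max C₁ C₂) (max C₃ C₄)
  have hFC' : ∀ x, ‖fderiv ℝ F x‖ ≤ C := fun x => (h₃ x).trans (by simp [C])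
  have hGC' : ∀ x, ‖fderiv ℝ G x‖ ≤ C := fun x => (h₄ x).trans (by simp [C])
  have hC : 0 ≤ C := (norm_nonneg _).trans (hFC' 0)
  rw [covariance_formula_of_bounded (C := C) hF hG (fun x => (h₁ x).trans (by simp [C])) hFC'
    (fun x => (h₂ x).trans (by simp [C])) hGC', ← integral_sinMeasure, integral_prod]
  refine .of_bound (C := ∑ i : ι, C * C) (Continuous.aestronglyMeasurable ?_)
    (ae_of_all _ fun q => (norm_sum_le _ _).trans (Finset.sum_le_sum fun i _ => ?_))
  · exact continuous_finsetSum _ fun i _ => ((continuous_pd hF i).comp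
      (continuous_fst.comp continuous_snd)).mul ((continuous_pd hG i).comp continuous_mix)
  · rw [norm_mul]
    exact mul_le_mul (norm_pd_le _ (hFC' _) i) (norm_pd_le _ (hGC' _) i) (norm_nonneg _) hC

/-- A majorant that does not depend on the cutoff, as dominated convergence requires. -/
lemma norm_pd_mul_le {χ F : (ι → ℝ) → ℝ} {C : ℝ} (hχ : ContDiff ℝ 1 χ) (hF : ContDiff ℝ 1 F)
    (h1 : ∀ x, ‖χ x‖ ≤ 1) (hC : ∀ x, ‖fderiv ℝ χ x‖ ≤ C) (i : ι) (x : ι → ℝ) :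
    ‖pd i (fun y => χ y * F y) x‖ ≤ ‖pd i F x‖ + C * ‖F x‖ := by
  have : pd i (fun y => χ y * F y) x = χ x * pd i F x + F x * pd i χ x := by
    rw [pd, fderiv_fun_mul (hχ.differentiable one_ne_zero x) (hF.differentiable one_ne_zero x)]
    simp [pd]
  rw [this]
  refine (norm_add_le _ _).trans (add_le_add ?_ ?_)
  · rw [norm_mul]
    exact mul_le_of_le_one_left (norm_nonneg _) (h1 x)
  · rw [norm_mul, mul_comm]
    exact mul_le_mul_of_nonneg_right (norm_pd_le _ (hC x) i) (norm_nonneg _)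

/-- The gaussian covariance formula for continuously differentiable functions in the gaussian
Sobolev space. -/
theorem covariance_formula {F G : (ι → ℝ) → ℝ} (hF : ContDiff ℝ 1 F) (hG : ContDiff ℝ 1 G)
    (hF2 : MemLp F 2 (gaussPi ι)) (hG2 : MemLp G 2 (gaussPi ι))
    (hF2' : ∀ i, MemLp (pd i F) 2 (gaussPi ι)) (hG2' : ∀ i, MemLp (pd i G) 2 (gaussPi ι)) :
    ∫ x, F x * G x ∂(gaussPi ι) - (∫ x, F x ∂(gaussPi ι)) * ∫ x, G x ∂(gaussPi ι) =
      ∫ q, ∑ i, pd i F q.2.1 * pd i G (mix q.1 q.2) ∂(angleGaussPi ι) := by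
  obtain ⟨χ, C, hC0, hχ, hχ1, hχs, hχ', hχe⟩ := exists_cutoff ι
  have hk : ∀ k, _ := fun k => covariance_formula_of_hasCompactSupport ((hχ k).mul hF)
    ((hχ k).mul hG) (hχs k).mul_right (hχs k).mul_right
  have hle : ∀ {H : (ι → ℝ) → ℝ} k x, ‖χ k x * H x‖ ≤ ‖H x‖ := fun k x => by
    rw [norm_mul]; exact mul_le_of_le_one_left (norm_nonneg _) (hχ1 k x)
  have hlim : ∀ {H : (ι → ℝ) → ℝ} x, Tendsto (fun k => χ k x * H x) atTop (𝓝 (H x)) :=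
    fun {H} x => tendsto_const_nhds.congr' <| (hχe x).mono fun k hk => by
      simp only [hk.self_of_nhds, one_mul]
  -- Near each point the cutoff is eventually the constant `1`, so the derivatives are eventually
  -- equal too.
  have hlim' : ∀ {H : (ι → ℝ) → ℝ} i x,
      Tendsto (fun k => pd i (fun y => χ k y * H y) x) atTop (𝓝 (pd i H x)) :=
    fun {H} i x => tendsto_const_nhds.congr' <| (hχe x).mono fun k hk => by
      have : (fun y => χ k y * H y) =ᶠ[𝓝 x] H := hk.mono fun y hy => by
        simp only [hy, one_mul]
      simp only [pd, this.fderiv_eq]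
  have t1 : ∀ {H : (ι → ℝ) → ℝ}, ContDiff ℝ 1 H → MemLp H 2 (gaussPi ι) →
      Tendsto (fun k => ∫ x, χ k x * H x ∂(gaussPi ι)) atTop (𝓝 (∫ x, H x ∂(gaussPi ι))) :=
    fun {H} hH hH2 => tendsto_integral_of_dominated_convergence (fun x => ‖H x‖)
      (fun k => ((hχ k).mul hH).continuous.aestronglyMeasurable)
      (hH2.integrable one_le_two).norm (fun k => ae_of_all _ fun x => hle k x)
      (ae_of_all _ fun x => hlim x)
  have t2 : Tendsto (fun k => ∫ x, (χ k x * F x) * (χ k x * G x) ∂(gaussPi ι)) atTop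
      (𝓝 (∫ x, F x * G x ∂(gaussPi ι))) := by
    refine tendsto_integral_of_dominated_convergence (fun x => ‖F x * G x‖)
      (fun k => (((hχ k).mul hF).mul ((hχ k).mul hG)).continuous.aestronglyMeasurable)
      (hF2.integrable_mul hG2).norm (fun k => ae_of_all _ fun x => ?_)
      (ae_of_all _ fun x => (hlim x).mul (hlim x))
    rw [norm_mul, norm_mul (F x)]
    exact mul_le_mul (hle k x) (hle k x) (norm_nonneg _) (norm_nonneg _)
  have hdom : ∀ {H : (ι → ℝ) → ℝ} (i : ι), MemLp H 2 (gaussPi ι) → MemLp (pd i H) 2 (gaussPi ι) →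
      MemLp (fun x => ‖pd i H x‖ + C * ‖H x‖) 2 (gaussPi ι) :=
    fun i hH hH' => hH'.norm.add (hH.norm.const_mul C)
  have t3 : Tendsto (fun k => ∫ q, ∑ i, pd i (fun x => χ k x * F x) q.2.1 *
        pd i (fun x => χ k x * G x) (mix q.1 q.2) ∂(angleGaussPi ι)) atTop
      (𝓝 (∫ q, ∑ i, pd i F q.2.1 * pd i G (mix q.1 q.2) ∂(angleGaussPi ι))) := by
    refine tendsto_integral_of_dominated_convergence
      (fun q => ∑ i, (‖pd i F q.2.1‖ + C * ‖F q.2.1‖) *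
        (‖pd i G (mix q.1 q.2)‖ + C * ‖G (mix q.1 q.2)‖))
      (fun k => (continuous_finsetSum _ fun i _ => ((continuous_pd ((hχ k).mul hF) i).comp
        (continuous_fst.comp continuous_snd)).mul
          ((continuous_pd ((hχ k).mul hG) i).comp continuous_mix)).aestronglyMeasurable)
      (integrable_finsetSum _ fun i _ =>
        ((hdom i hF2 (hF2' i)).comp_measurePreserving measurePreserving_angle_fst).integrable_mul
        ((hdom i hG2 (hG2' i)).comp_measurePreserving measurePreserving_angle_mix))
      (fun k => ae_of_all _ fun q => (norm_sum_le _ _).trans (Finset.sum_le_sum fun i _ => ?_))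
      (ae_of_all _ fun q => tendsto_finsetSum _ fun i _ => (hlim' i _).mul (hlim' i _))
    rw [norm_mul]
    exact mul_le_mul (norm_pd_mul_le (hχ k) hF (hχ1 k) (hχ' k) i _)
      (norm_pd_mul_le (hχ k) hG (hχ1 k) (hχ' k) i _) (norm_nonneg _) (by positivity)
  exact tendsto_nhds_unique ((t2.sub ((t1 hF hF2).mul (t1 hG hG2))).congr hk) t3

/-- The gaussian Poincaré inequality. -/
theorem poincare_gaussPi {F : (ι → ℝ) → ℝ} (hF : ContDiff ℝ 1 F) (hF2 : MemLp F 2 (gaussPi ι))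
    (hF2' : ∀ i, MemLp (pd i F) 2 (gaussPi ι)) :
    Var[F; gaussPi ι] ≤ ∑ i, ∫ x, pd i F x ^ 2 ∂(gaussPi ι) := by
  have h1 : ∀ i, Integrable (fun q : ℝ × ((ι → ℝ) × (ι → ℝ)) => pd i F q.2.1 ^ 2)
      (angleGaussPi ι) := fun i =>
    ((hF2' i).comp_measurePreserving measurePreserving_angle_fst).integrable_sq
  have h2 : ∀ i, Integrable (fun q : ℝ × ((ι → ℝ) × (ι → ℝ)) => pd i F (mix q.1 q.2) ^ 2)
      (angleGaussPi ι) := fun i =>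
    ((hF2' i).comp_measurePreserving measurePreserving_angle_mix).integrable_sq
  have e : ∀ (i : ι) {u : ℝ × ((ι → ℝ) × (ι → ℝ)) → (ι → ℝ)},
      MeasurePreserving u (angleGaussPi ι) (gaussPi ι) →
      ∫ q, pd i F (u q) ^ 2 ∂(angleGaussPi ι) = ∫ x, pd i F x ^ 2 ∂(gaussPi ι) := by
    intro i u hu
    exact integral_comp_measurePreserving hu ((continuous_pd hF i).pow 2).aestronglyMeasurable
  rw [variance_eq_sub hF2]
  have hc := covariance_formula hF hF hF2 hF2 hF2' hF2'
  simp only [Pi.pow_apply, sq] at hc ⊢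
  rw [hc, integral_finsetSum _ fun i _ => ?_]
  · refine Finset.sum_le_sum fun i _ => ?_
    -- By `ab ≤ a²/2 + b²/2`; both points are standard gaussian, so the two halves have the same
    -- integral.
    calc _ ≤ ∫ q : ℝ × ((ι → ℝ) × (ι → ℝ)), (pd i F q.2.1 ^ 2 / 2 + pd i F (mix q.1 q.2) ^ 2 / 2)
            ∂(angleGaussPi ι) := by
          refine integral_mono (((hF2' i).comp_measurePreserving
            measurePreserving_angle_fst).integrable_mul
            ((hF2' i).comp_measurePreserving measurePreserving_angle_mix))
            (((h1 i).div_const 2).add ((h2 i).div_const 2)) fun q => ?_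
          beta_reduce
          nlinarith [sq_nonneg (pd i F q.2.1 - pd i F (mix q.1 q.2))]
      _ = _ := by
          rw [integral_add ((h1 i).div_const 2) ((h2 i).div_const 2), integral_div, integral_div,
            e i measurePreserving_angle_fst, e i measurePreserving_angle_mix, add_halves]
          simp only [sq]
  · exact ((hF2' i).comp_measurePreserving measurePreserving_angle_fst).integrable_mul
      ((hF2' i).comp_measurePreserving measurePreserving_angle_mix)

end

/-! ### The Poincaré inequality for pairs. -/

section

section
variable {ι : Type*} [Fintype ι] [DecidableEq ι]

/-- The gaussian Poincaré inequality for a pair of independent standard gaussian vectors. -/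
theorem poincare_gaussPi_prod {H : (ι → ℝ) × (ι → ℝ) → ℝ} (hH : ContDiff ℝ 1 H)
    (hH2 : MemLp H 2 ((gaussPi ι).prod (gaussPi ι)))
    (h1 : ∀ i, MemLp (fun p => fderiv ℝ H p (Pi.single i 1, 0)) 2
      ((gaussPi ι).prod (gaussPi ι)))
    (h2 : ∀ i, MemLp (fun p => fderiv ℝ H p (0, Pi.single i 1)) 2
      ((gaussPi ι).prod (gaussPi ι))) :
    Var[H; (gaussPi ι).prod (gaussPi ι)] ≤
      ∑ i, ∫ p, fderiv ℝ H p (Pi.single i 1, 0) ^ 2 ∂((gaussPi ι).prod (gaussPi ι)) +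
      ∑ i, ∫ p, fderiv ℝ H p (0, Pi.single i 1) ^ 2 ∂((gaussPi ι).prod (gaussPi ι)) := by
  -- A pair of standard gaussian vectors is one standard gaussian vector indexed by `ι ⊕ ι`.
  let L : (ι ⊕ ι → ℝ) →L[ℝ] (ι → ℝ) × (ι → ℝ) :=
    (ContinuousLinearMap.pi fun i => ContinuousLinearMap.proj (Sum.inl i)).prod
      (ContinuousLinearMap.pi fun i => ContinuousLinearMap.proj (Sum.inr i))
  have hL : MeasurePreserving L (gaussPi (ι ⊕ ι)) ((gaussPi ι).prod (gaussPi ι)) :=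
    measurePreserving_sumPiEquivProdPi (fun _ : ι ⊕ ι => gaussianReal 0 1)
  have hpd : ∀ k, pd k (H ∘ L) = fun z => fderiv ℝ H (L z) (L (Pi.single k 1)) := by
    intro k
    ext z
    have := (hH.differentiable one_ne_zero (L z)).hasFDerivAt.comp z L.hasFDerivAt
    rw [pd, this.fderiv]
    rfl
  have el : ∀ i, L (Pi.single (Sum.inl i) 1) = (Pi.single i 1, 0) := fun i => by
    ext j <;> simp [L, Pi.single_apply]
  have er : ∀ i, L (Pi.single (Sum.inr i) 1) = (0, Pi.single i 1) := fun i => by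
    ext j <;> simp [L, Pi.single_apply]
  have key := poincare_gaussPi (F := H ∘ L) (hH.comp L.contDiff)
    (hH2.comp_measurePreserving hL) (fun k => by
      rw [hpd]
      rcases k with i | i
      · rw [el]; exact (h1 i).comp_measurePreserving hL
      · rw [er]; exact (h2 i).comp_measurePreserving hL)
  rw [Fintype.sum_sum_type, ← variance_map (by rw [hL.map_eq]; exact hH2.aemeasurable)
    hL.measurable.aemeasurable, hL.map_eq] at key
  refine key.trans (add_le_add (Finset.sum_le_sum fun i _ => ?_)
    (Finset.sum_le_sum fun i _ => ?_))
  · rw [hpd, el]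
    exact (integral_comp_measurePreserving hL (f := fun p => fderiv ℝ H p (Pi.single i 1, 0) ^ 2)
      ((h1 i).aestronglyMeasurable.pow 2)).le
  · rw [hpd, er]
    exact (integral_comp_measurePreserving hL (f := fun p => fderiv ℝ H p (0, Pi.single i 1) ^ 2)
      ((h2 i).aestronglyMeasurable.pow 2)).le

end

/-! ### Stein's equation. -/

lemma integrable_exp_neg_sq_div_two : Integrable fun t : ℝ => Real.exp (-t ^ 2 / 2) := by
  have := integrable_exp_neg_mul_sq (b := 1 / 2) (by norm_num)
  refine this.congr (ae_of_all _ fun t => ?_)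
  ring_nf

lemma integrable_mul_exp_neg_sq_div_two :
    Integrable fun t : ℝ => t * Real.exp (-t ^ 2 / 2) := by
  have := integrable_mul_exp_neg_mul_sq (b := 1 / 2) (by norm_num)
  refine this.congr (ae_of_all _ fun t => ?_)
  ring_nf

lemma hasDerivAt_exp_neg_sq_div_two (t : ℝ) :
    HasDerivAt (fun t : ℝ => Real.exp (-t ^ 2 / 2)) (-(t * Real.exp (-t ^ 2 / 2))) t := by
  have h : HasDerivAt (fun t : ℝ => -t ^ 2 / 2) (-t) t := by
    refine ((hasDerivAt_pow 2 t).neg.div_const 2).congr_deriv ?_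
    ring
  refine h.exp.congr_deriv ?_
  ring

lemma tendsto_exp_neg_sq_div_two {l : Filter ℝ} (h : Tendsto (fun t : ℝ => t ^ 2) l atTop) :
    Tendsto (fun t : ℝ => Real.exp (-t ^ 2 / 2)) l (𝓝 0) := by
  refine Real.tendsto_exp_atBot.comp ?_
  have := (tendsto_neg_atTop_atBot.comp h).atBot_div_const (r := 2) two_pos
  exact this

lemma integral_Ioi_mul_exp (x : ℝ) :
    ∫ t in Set.Ioi x, t * Real.exp (-t ^ 2 / 2) = Real.exp (-x ^ 2 / 2) := by
  have := integral_Ioi_of_hasDerivAt_of_tendsto' (a := x)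
    (fun t _ => (hasDerivAt_exp_neg_sq_div_two t).neg)
    (by simpa using integrable_mul_exp_neg_sq_div_two.integrableOn)
    (tendsto_exp_neg_sq_div_two (tendsto_pow_atTop two_ne_zero)).neg
  simpa using this

lemma integral_Iic_mul_exp (x : ℝ) :
    ∫ t in Set.Iic x, t * Real.exp (-t ^ 2 / 2) = - Real.exp (-x ^ 2 / 2) := by
  have := integral_Iic_of_hasDerivAt_of_tendsto' (a := x)
    (fun t _ => (hasDerivAt_exp_neg_sq_div_two t).neg)
    (by simpa using integrable_mul_exp_neg_sq_div_two.integrableOn)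
    (tendsto_exp_neg_sq_div_two (l := atBot) (by
      have := (tendsto_pow_atTop (α := ℝ) two_ne_zero).comp tendsto_neg_atBot_atTop
      simpa [Function.comp_def] using this)).neg
  simpa using this

/-- Stein's equation: for a continuous test function with values in `[0, 1]` there is a
continuously differentiable solution whose derivative is bounded by `2`. -/
theorem exists_stein_solution {h : ℝ → ℝ} (hc : Continuous h) (h0 : ∀ x, 0 ≤ h x)
    (h1 : ∀ x, h x ≤ 1) : ∃ f f' : ℝ → ℝ, (∀ x, HasDerivAt f (f' x) x) ∧ Continuous f' ∧
      (∀ x, |f' x| ≤ 2) ∧ ∀ x, f' x - x * f x = h x - ∫ t, h t ∂(gaussianReal 0 1) := by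
  set c := ∫ t, h t ∂(gaussianReal 0 1) with hcdef
  have hint : Integrable h (gaussianReal 0 1) := .of_bound hc.aestronglyMeasurable 1
    (ae_of_all _ fun x => by rw [Real.norm_of_nonneg (h0 x)]; exact h1 x)
  have hc0 : 0 ≤ c := integral_nonneg h0
  have hc1 : c ≤ 1 := by
    have := integral_mono hint (integrable_const (1 : ℝ)) h1
    simpa using this
  have hb : ∀ x, |h x - c| ≤ 1 := fun x => by
    rw [abs_le]; constructor <;> linarith [h0 x, h1 x]
  let w : ℝ → ℝ := fun t => (h t - c) * Real.exp (-t ^ 2 / 2)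
  have hwc : Continuous w := by fun_prop
  have hwi : Integrable w := integrable_exp_neg_sq_div_two.bdd_mul (c := 1)
    (hc.sub continuous_const).aestronglyMeasurable (ae_of_all _ hb)
  have hw0 : ∫ t, w t = 0 := by
    have e : ∫ t, (h t - c) ∂(gaussianReal 0 1) = 0 := by
      rw [integral_sub hint (integrable_const c)]
      simp [hcdef]
    rw [integral_gaussianReal_eq_integral_smul one_ne_zero] at e
    have e2 : ∀ t, gaussianPDFReal 0 1 t • (h t - c) = (√(2 * Real.pi))⁻¹ * w t := fun t => by
      simp only [gaussianPDFReal, w, smul_eq_mul, NNReal.coe_one, sub_zero, mul_one]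
      ring
    simp only [e2, integral_const_mul] at e
    exact (mul_eq_zero.1 e).resolve_left (by positivity)
  let F : ℝ → ℝ := fun x => ∫ t in Set.Iic x, w t
  -- The total integral of `w` vanishes, so either tail represents `F`; each sign of `x` uses the
  -- tail not containing the origin.
  have hF2 : ∀ x, F x = - ∫ t in Set.Ioi x, w t := fun x => by
    have := intervalIntegral.integral_Iic_add_Ioi (b := x) hwi.integrableOn hwi.integrableOn
    rw [hw0] at this
    simp only [F]; linarith
  have hFd : ∀ x, HasDerivAt F (w x) x := fun x => by
    have e : F = fun y => F 0 + ∫ t in (0 : ℝ)..y, w t := by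
      ext y
      rw [← intervalIntegral.integral_Iic_sub_Iic hwi.integrableOn hwi.integrableOn]
      simp only [F]; ring
    rw [e]
    exact (intervalIntegral.integral_hasDerivAt_right (hwc.intervalIntegrable _ _)
      (hwc.stronglyMeasurableAtFilter _ _) hwc.continuousAt).const_add _
  have hFc : Continuous F := continuous_iff_continuousAt.2 fun x => (hFd x).continuousAt
  have hwle : ∀ t, |w t| ≤ Real.exp (-t ^ 2 / 2) := fun t => by
    rw [abs_mul, abs_of_nonneg (Real.exp_pos _).le]
    exact mul_le_of_le_one_left (Real.exp_pos _).le (hb t)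
  -- On the chosen tail `|x| ≤ |t|`, so `|x|` can be replaced by `|t|` under the integral, and `t
  -- exp(-t²/2)` integrates explicitly.
  have hFb : ∀ x, |x * F x| ≤ Real.exp (-x ^ 2 / 2) := by
    intro x
    have hn : ∀ s : Set ℝ, |∫ t in s, w t| ≤ ∫ t in s, ‖w t‖ :=
      fun s => norm_integral_le_integral_norm w
    rw [abs_mul]
    rcases le_total 0 x with hx | hx
    · rw [hF2, abs_neg, abs_of_nonneg hx, ← integral_Ioi_mul_exp]
      refine (mul_le_mul_of_nonneg_left (hn _) hx).trans ?_
      rw [← integral_const_mul]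
      refine setIntegral_mono_on (hwi.norm.const_mul x).integrableOn
        integrable_mul_exp_neg_sq_div_two.integrableOn measurableSet_Ioi fun t ht => ?_
      exact mul_le_mul (le_of_lt ht) (hwle t) (norm_nonneg _) (hx.trans (le_of_lt ht))
    · rw [abs_of_nonpos hx, ← neg_neg (Real.exp _), ← integral_Iic_mul_exp, ← integral_neg]
      refine (mul_le_mul_of_nonneg_left (hn _) (neg_nonneg.2 hx)).trans ?_
      rw [← integral_const_mul]
      refine setIntegral_mono_on (hwi.norm.const_mul (-x)).integrableOn
        integrable_mul_exp_neg_sq_div_two.neg.integrableOn measurableSet_Iic fun t ht => ?_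
      rw [← neg_mul]
      exact mul_le_mul (neg_le_neg ht) (hwle t) (norm_nonneg _)
        (neg_nonneg.2 (le_trans ht hx))
  refine ⟨fun x => Real.exp (x ^ 2 / 2) * F x,
    fun x => x * (Real.exp (x ^ 2 / 2) * F x) + (h x - c), fun x => ?_, ?_, fun x => ?_,
    fun x => by ring⟩
  · have e1 : HasDerivAt (fun t : ℝ => Real.exp (t ^ 2 / 2)) (Real.exp (x ^ 2 / 2) * x) x := by
      have h : HasDerivAt (fun t : ℝ => t ^ 2 / 2) x x := by
        refine ((hasDerivAt_pow 2 x).div_const 2).congr_deriv ?_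
        ring
      exact h.exp
    refine (e1.mul (hFd x)).congr_deriv ?_
    have : Real.exp (x ^ 2 / 2) * Real.exp (-x ^ 2 / 2) = 1 := by
      rw [← Real.exp_add, ← Real.exp_zero]; congr 1; ring
    simp only [w]
    linear_combination (h x - c) * this
  · fun_prop
  -- The solution is `exp(x²/2) F(x)`, so `f' = x f + (h - c)` is a sum of two terms, each bounded
  -- by `1`.
  · have e : |x * (Real.exp (x ^ 2 / 2) * F x)| ≤ 1 := by
      rw [mul_left_comm, abs_mul, abs_of_pos (Real.exp_pos _)]
      refine (mul_le_mul_of_nonneg_left (hFb x) (Real.exp_pos _).le).trans ?_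
      rw [← Real.exp_add, ← Real.exp_zero]
      apply le_of_eq; congr 1; ring
    calc _ ≤ _ := abs_add_le _ _
      _ ≤ 1 + 1 := add_le_add e (hb x)
      _ = 2 := by norm_num

end

/-! ### Variance of the pairing of gradients at a fixed angle. -/

section

variable {ι : Type*} [Fintype ι] [DecidableEq ι]

lemma contDiff_pd {G : (ι → ℝ) → ℝ} (hG : ContDiff ℝ 2 G) (i : ι) : ContDiff ℝ 1 (pd i G) :=
  (hG.fderiv_right (m := 1) (by norm_num)).clm_apply contDiff_const

/-- The pairing `⟨∇G(x), ∇G(y)⟩` of the gradients at `x` and at the rotated point `y`. -/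
noncomputable def gradPairing (G : (ι → ℝ) → ℝ) (θ : ℝ) (p : (ι → ℝ) × (ι → ℝ)) : ℝ :=
  ∑ j, pd j G p.1 * pd j G (mix θ p)

/-- The `i`-th coordinate of `∇²G(x) ∇G(y)`. -/
noncomputable def hessGrad (G : (ι → ℝ) → ℝ) (i : ι) (x y : ι → ℝ) : ℝ :=
  ∑ j, pd i (pd j G) x * pd j G y

omit [DecidableEq ι] in
lemma contDiff_mix (θ : ℝ) : ContDiff ℝ 1 (mix (ι := ι) θ) := by
  unfold mix
  fun_prop

lemma contDiff_gradPairing {G : (ι → ℝ) → ℝ} (hG : ContDiff ℝ 2 G) (θ : ℝ) :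
    ContDiff ℝ 1 (gradPairing G θ) :=
  ContDiff.sum fun j _ => ((contDiff_pd hG j).comp contDiff_fst).mul
    ((contDiff_pd hG j).comp (contDiff_mix θ))

lemma continuous_hessGrad {G : (ι → ℝ) → ℝ} (hG : ContDiff ℝ 2 G) (i : ι) {T : Type*}
    [TopologicalSpace T] {u v : T → (ι → ℝ)} (hu : Continuous u) (hv : Continuous v) :
    Continuous fun t => hessGrad G i (u t) (v t) :=
  continuous_finsetSum _ fun j _ => ((continuous_pd (contDiff_pd hG j) i).comp hu).mul
    ((contDiff_pd hG j).continuous.comp hv)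

lemma fderiv_gradPairing {G : (ι → ℝ) → ℝ} (hG : ContDiff ℝ 2 G) (θ : ℝ)
    (p v : (ι → ℝ) × (ι → ℝ)) :
    fderiv ℝ (gradPairing G θ) p v =
      ∑ j, (fderiv ℝ (pd j G) p.1 v.1 * pd j G (mix θ p) +
        pd j G p.1 * fderiv ℝ (pd j G) (mix θ p) (mix θ v)) := by
  have hmix : HasFDerivAt (mix (ι := ι) θ)
      ((ContinuousLinearMap.fst ℝ (ι → ℝ) (ι → ℝ)).comp (ContinuousLinearMap.rotation θ)) p :=
    ((ContinuousLinearMap.fst ℝ (ι → ℝ) (ι → ℝ)).comp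
      (ContinuousLinearMap.rotation θ)).hasFDerivAt
  have hd : ∀ j x, HasFDerivAt (pd j G) (fderiv ℝ (pd j G) x) x := fun j x =>
    ((contDiff_pd hG j).differentiable one_ne_zero x).hasFDerivAt
  have h : HasFDerivAt (gradPairing G θ) _ p := HasFDerivAt.fun_sum (u := Finset.univ) fun j _ =>
    ((hd j p.1).comp p hasFDerivAt_fst).mul ((hd j (mix θ p)).comp p hmix)
  rw [h.fderiv]
  simp only [sum_apply, add_apply,
    smul_apply, ContinuousLinearMap.comp_apply, smul_eq_mul, Function.comp,
    ContinuousLinearMap.coe_fst', ← mix_eq_rotation]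
  refine Finset.sum_congr rfl fun j _ => ?_
  ring

lemma fderiv_gradPairing_inl {G : (ι → ℝ) → ℝ} (hG : ContDiff ℝ 2 G) (θ : ℝ)
    (p : (ι → ℝ) × (ι → ℝ)) (i : ι) :
    fderiv ℝ (gradPairing G θ) p (Pi.single i 1, 0) =
      hessGrad G i p.1 (mix θ p) + Real.cos θ * hessGrad G i (mix θ p) p.1 := by
  rw [fderiv_gradPairing hG, hessGrad, hessGrad, Finset.mul_sum, ← Finset.sum_add_distrib]
  refine Finset.sum_congr rfl fun j _ => ?_
  have : mix θ (Pi.single i 1, (0 : ι → ℝ)) = Real.cos θ • Pi.single i 1 := by simp [mix]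
  rw [this, map_smul]
  simp only [pd, smul_eq_mul]
  ring

lemma fderiv_gradPairing_inr {G : (ι → ℝ) → ℝ} (hG : ContDiff ℝ 2 G) (θ : ℝ)
    (p : (ι → ℝ) × (ι → ℝ)) (i : ι) :
    fderiv ℝ (gradPairing G θ) p (0, Pi.single i 1) =
      Real.sin θ * hessGrad G i (mix θ p) p.1 := by
  rw [fderiv_gradPairing hG, hessGrad, Finset.mul_sum]
  refine Finset.sum_congr rfl fun j _ => ?_
  have : mix θ ((0 : ι → ℝ), Pi.single i 1) = Real.sin θ • Pi.single i 1 := by simp [mix]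
  rw [this, map_smul, map_zero]
  simp only [pd, smul_eq_mul]
  ring

/-- `HessGradBound G K` says that `𝔼‖∇²G(U) ∇G(V)‖² ≤ K²` for any two standard gaussian vectors
`U` and `V` that are functions of a pair of independent ones. -/
def HessGradBound (G : (ι → ℝ) → ℝ) (K : ℝ≥0) : Prop :=
  ∀ u v : (ι → ℝ) × (ι → ℝ) → (ι → ℝ),
    MeasurePreserving u ((gaussPi ι).prod (gaussPi ι)) (gaussPi ι) →
    MeasurePreserving v ((gaussPi ι).prod (gaussPi ι)) (gaussPi ι) →
    ∫⁻ p, ∑ i, ‖hessGrad G i (u p) (v p)‖ₑ ^ 2 ∂((gaussPi ι).prod (gaussPi ι)) ≤ (K : ℝ≥0∞) ^ 2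

omit [DecidableEq ι] in
lemma memLp_and_sum_integral_sq_le {α : Type*} [MeasurableSpace α] {μ : Measure α}
    {f : ι → α → ℝ} {K : ℝ≥0} (hf : ∀ i, AEStronglyMeasurable (f i) μ)
    (h : ∫⁻ a, ∑ i, ‖f i a‖ₑ ^ 2 ∂μ ≤ (K : ℝ≥0∞) ^ 2) :
    (∀ i, MemLp (f i) 2 μ) ∧ ∑ i, ∫ a, f i a ^ 2 ∂μ ≤ (K : ℝ) ^ 2 := by
  have hlt : ∀ i, MemLp (f i) 2 μ := by
    intro i
    refine ⟨hf i, ?_⟩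
    rw [eLpNorm_lt_top_iff_lintegral_rpow_enorm_lt_top two_ne_zero ENNReal.ofNat_ne_top]
    simp only [ENNReal.toReal_ofNat, ENNReal.rpow_ofNat]
    refine (lintegral_mono fun a => ?_).trans_lt (h.trans_lt (by finiteness))
    exact Finset.single_le_sum (f := fun i => ‖f i a‖ₑ ^ 2) (fun _ _ => zero_le)
      (Finset.mem_univ i)
  refine ⟨hlt, ?_⟩
  rw [← integral_finsetSum _ fun i _ => (hlt i).integrable_sq,
    integral_eq_lintegral_of_nonneg_ae
      (ae_of_all _ fun a => Finset.sum_nonneg fun i _ => sq_nonneg _)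
      (integrable_finsetSum _ fun i _ => (hlt i).integrable_sq).aestronglyMeasurable]
  have e : ∀ a, ENNReal.ofReal (∑ i, f i a ^ 2) = ∑ i, ‖f i a‖ₑ ^ 2 := fun a => by
    rw [ENNReal.ofReal_sum_of_nonneg fun i _ => sq_nonneg _]
    refine Finset.sum_congr rfl fun i _ => ?_
    rw [← sq_abs, ENNReal.ofReal_pow (abs_nonneg _), ← Real.norm_eq_abs, ofReal_norm]
  simp only [e]
  refine ENNReal.toReal_le_of_le_ofReal (sq_nonneg _) ?_
  rw [ENNReal.ofReal_pow K.coe_nonneg, ENNReal.ofReal_coe_nnreal]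
  exact h

/-- Hölder's inequality with `1/4 + 1/4 = 1/2`; this is where fourth moments of the gradient are
needed. -/
lemma memLp_gradPairing {G : (ι → ℝ) → ℝ} (hG4 : ∀ i, MemLp (pd i G) 4 (gaussPi ι)) (θ : ℝ) :
    MemLp (gradPairing G θ) 2 ((gaussPi ι).prod (gaussPi ι)) := by
  refine memLp_finsetSum _ fun j _ => ?_
  have : ENNReal.HolderTriple 4 4 2 := ⟨by
    have : (4 : ℝ≥0∞) = 2 * 2 := by norm_num
    rw [this, ENNReal.mul_inv (by simp) (by simp), ← mul_add, ENNReal.inv_two_add_inv_two, mul_one]⟩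
  exact MemLp.mul ((hG4 j).comp_measurePreserving (measurePreserving_mix θ))
    ((hG4 j).comp_measurePreserving measurePreserving_fst)

/-- With `a = ∇²G(x)∇G(y)` and `b = ∇²G(y)∇G(x)`, the gradients in the two vectors are `a + cos θ b`
and `sin θ b`. Their squared norms add up to at most `2|a|² + 2|b|²`, hence `4K²` in mean. -/
lemma variance_gradPairing_le {G : (ι → ℝ) → ℝ} (hG : ContDiff ℝ 2 G)
    (hG4 : ∀ i, MemLp (pd i G) 4 (gaussPi ι)) {K : ℝ≥0} (hK : HessGradBound G K) (θ : ℝ) :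
    Var[gradPairing G θ; (gaussPi ι).prod (gaussPi ι)] ≤ (2 * K) ^ 2 := by
  have hmix := continuous_mix_right (ι := ι) θ
  obtain ⟨ha, ha2⟩ := memLp_and_sum_integral_sq_le
    (f := fun i p => hessGrad G i (Prod.fst p) (mix θ p))
    (fun i => (continuous_hessGrad hG i continuous_fst hmix).aestronglyMeasurable)
    (hK _ _ measurePreserving_fst (measurePreserving_mix θ))
  obtain ⟨hb, hb2⟩ := memLp_and_sum_integral_sq_le
    (f := fun i p => hessGrad G i (mix θ p) (Prod.fst p))
    (fun i => (continuous_hessGrad hG i hmix continuous_fst).aestronglyMeasurable)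
    (hK _ _ (measurePreserving_mix θ) measurePreserving_fst)
  refine (poincare_gaussPi_prod (contDiff_gradPairing hG θ) (memLp_gradPairing hG4 θ)
    (fun i => ?_) fun i => ?_).trans ?_
  · simp only [fderiv_gradPairing_inl hG]
    exact (ha i).add ((hb i).const_mul _)
  · simp only [fderiv_gradPairing_inr hG]
    exact (hb i).const_mul _
  · simp only [fderiv_gradPairing_inl hG, fderiv_gradPairing_inr hG]
    rw [← Finset.sum_add_distrib]
    calc _ ≤ ∑ i, (2 * ∫ p, hessGrad G i (Prod.fst p) (mix θ p) ^ 2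
              ∂((gaussPi ι).prod (gaussPi ι)) +
            2 * ∫ p, hessGrad G i (mix θ p) (Prod.fst p) ^ 2
              ∂((gaussPi ι).prod (gaussPi ι))) := by
          refine Finset.sum_le_sum fun i _ => ?_
          rw [← integral_const_mul, ← integral_const_mul,
            ← integral_add (f := fun p => (hessGrad G i (Prod.fst p) (mix θ p) +
                Real.cos θ * hessGrad G i (mix θ p) (Prod.fst p)) ^ 2)
              (g := fun p => (Real.sin θ * hessGrad G i (mix θ p) (Prod.fst p)) ^ 2)
              ((ha i).add ((hb i).const_mul _)).integrable_sq ((hb i).const_mul _).integrable_sq,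
            ← integral_add ((ha i).integrable_sq.const_mul 2) ((hb i).integrable_sq.const_mul 2)]
          refine integral_mono
            (((ha i).add ((hb i).const_mul _)).integrable_sq.add
              ((hb i).const_mul _).integrable_sq)
            (((ha i).integrable_sq.const_mul 2).add ((hb i).integrable_sq.const_mul 2))
            fun p => ?_
          beta_reduce
          have := Real.sin_sq_add_cos_sq θ
          nlinarith [sq_nonneg (hessGrad G i p.1 (mix θ p) -
            Real.cos θ * hessGrad G i (mix θ p) p.1), sq_nonneg (hessGrad G i (mix θ p) p.1),
            sq_nonneg (Real.sin θ * hessGrad G i (mix θ p) p.1)]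
      _ ≤ 2 * K ^ 2 + 2 * K ^ 2 := by
          rw [Finset.sum_add_distrib, ← Finset.mul_sum, ← Finset.mul_sum]
          linarith
      _ = _ := by ring

end

/-! ### From test functions to total variation; the bound for functions of a standard gaussian
vector. -/

section

/-- The total variation distance is controlled by continuous test functions with values in
`[0, 1]`. -/
lemma tvDist_le_of_forall_continuous {μ ν : Measure ℝ} [IsProbabilityMeasure μ]
    [IsProbabilityMeasure ν] {C : ℝ}
    (h : ∀ f : ℝ → ℝ, Continuous f → (∀ x, 0 ≤ f x) → (∀ x, f x ≤ 1) →
      |∫ x, f x ∂μ - ∫ x, f x ∂ν| ≤ C) : tvDist μ ν ≤ ENNReal.ofReal C := by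
  refine iSup₂_le fun B hB => ENNReal.ofReal_le_ofReal (le_of_forall_pos_le_add fun ε hε => ?_)
  -- Indicators of closed sets are limits of continuous functions with values in `[0, 1]`.
  have hclosed : ∀ F : Set ℝ, IsClosed F → |μ.real F - ν.real F| ≤ C := by
    intro F hF
    have hpos : ∀ n : ℕ, (0 : ℝ) < 1 / ((n : ℝ) + 1) := fun n => Nat.one_div_pos_of_nat
    have t1 := tendsto_integral_thickenedIndicator_of_isClosed μ hF hpos
      tendsto_one_div_add_atTop_nhds_zero_nat
    have t2 := tendsto_integral_thickenedIndicator_of_isClosed ν hF hpos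
      tendsto_one_div_add_atTop_nhds_zero_nat
    refine le_of_tendsto (t1.sub t2).abs (Eventually.of_forall fun n => h _ ?_ ?_ ?_)
    · exact NNReal.continuous_coe.comp (thickenedIndicator (hpos n) F).continuous
    · exact fun x => NNReal.coe_nonneg _
    · exact fun x => by exact_mod_cast thickenedIndicator_le_one (hpos n) F x
  -- Inner regularity of the sum `μ + ν` gives one closed set that approximates `B` for both
  -- measures.
  obtain ⟨F, hFB, hF, hlt⟩ := hB.exists_isClosed_sdiff_lt (μ := μ + ν) (measure_ne_top _ _)
    (ε := ENNReal.ofReal (ε / 2)) (by simpa using hε)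
  have hd : ∀ ρ : Measure ℝ, IsProbabilityMeasure ρ → ρ ≤ μ + ν →
      |ρ.real B - ρ.real F| ≤ ε / 2 := by
    intro ρ _ hρ
    rw [← measureReal_sdiff hFB hF.measurableSet, abs_of_nonneg measureReal_nonneg]
    exact ENNReal.toReal_le_of_le_ofReal (by positivity) ((hρ _).trans hlt.le)
  have h1 := abs_le.1 (hd μ inferInstance (Measure.le_add_right le_rfl))
  have h2 := abs_le.1 (hd ν inferInstance (Measure.le_add_left le_rfl))
  have h3 := abs_le.1 (hclosed F hF)
  rw [abs_le]
  constructor <;> linarith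

/-- The difference is `𝔼[φ (m - H)]`, where `m` is the mean of `H`, and the mean absolute deviation
of `H` is at most its standard deviation. -/
lemma abs_integral_mul_integral_sub_le {α : Type*} [MeasurableSpace α] {μ : Measure α}
    [IsProbabilityMeasure μ] {φ H : α → ℝ} {M s : ℝ} (hs : 0 ≤ s)
    (hφm : AEStronglyMeasurable φ μ) (hφ : ∀ a, |φ a| ≤ M) (hH : MemLp H 2 μ)
    (hvar : Var[H; μ] ≤ s ^ 2) :
    |(∫ a, φ a ∂μ) * (∫ a, H a ∂μ) - ∫ a, φ a * H a ∂μ| ≤ M * s := by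
  set m := ∫ a, H a ∂μ
  have hM : 0 ≤ M := by
    obtain ⟨a⟩ := nonempty_of_isProbabilityMeasure μ
    exact (abs_nonneg _).trans (hφ a)
  have hHi := hH.integrable one_le_two
  have hφi : Integrable φ μ := .of_bound hφm M (ae_of_all _ hφ)
  have hY : MemLp (fun a => |H a - m|) 2 μ := (hH.sub (memLp_const m)).norm
  have hYi := hY.integrable one_le_two
  have h1 : ∫ a, |H a - m| ∂μ ≤ s := by
    have := variance_nonneg (fun a => |H a - m|) μ
    rw [variance_eq_sub hY] at this
    have e : Var[H; μ] = ∫ a, ((fun a => |H a - m|) ^ 2) a ∂μ := by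
      rw [variance_eq_integral hH.aemeasurable]
      simp [m]
    rw [← e] at this
    exact abs_le_of_sq_le_sq' (by linarith) hs |>.2
  calc _ = |∫ a, φ a * (m - H a) ∂μ| := by
        congr 1
        simp only [mul_sub]
        rw [integral_sub (hφi.mul_const m) (hHi.bdd_mul hφm (ae_of_all _ hφ)), integral_mul_const]
    _ ≤ ∫ a, M * |H a - m| ∂μ := by
        rw [← Real.norm_eq_abs]
        refine norm_integral_le_of_norm_le (hYi.const_mul M) (ae_of_all _ fun a => ?_)
        rw [norm_mul, Real.norm_eq_abs, Real.norm_eq_abs, abs_sub_comm]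
        exact mul_le_mul_of_nonneg_right (hφ a) (abs_nonneg _)
    _ ≤ M * s := by
        rw [integral_const_mul]
        exact mul_le_mul_of_nonneg_left h1 hM

variable {ι : Type*} [Fintype ι] [DecidableEq ι]

lemma integrable_gradPairing_angle {G : (ι → ℝ) → ℝ} (hp : ∀ i, MemLp (pd i G) 2 (gaussPi ι)) :
    Integrable (fun q : ℝ × ((ι → ℝ) × (ι → ℝ)) => gradPairing G q.1 q.2) (angleGaussPi ι) :=
  integrable_finsetSum _ fun i _ =>
    ((hp i).comp_measurePreserving measurePreserving_angle_fst).integrable_mul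
      ((hp i).comp_measurePreserving measurePreserving_angle_mix)

/-- The estimate is made at each fixed angle and then averaged. Thus only the gaussian variance at
fixed `θ` enters, not the variation of the mean with `θ`. -/
lemma abs_integral_gradPairing_le {G : (ι → ℝ) → ℝ} (hG : ContDiff ℝ 2 G)
    (hG4 : ∀ i, MemLp (pd i G) 4 (gaussPi ι)) {K : ℝ≥0} (hK : HessGradBound G K)
    {φ : (ι → ℝ) → ℝ} {M : ℝ} (hφc : Continuous φ) (hφ : ∀ x, |φ x| ≤ M) :
    |(∫ x, φ x ∂(gaussPi ι)) * (∫ q, gradPairing G q.1 q.2 ∂(angleGaussPi ι)) -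
      ∫ q, φ q.2.1 * gradPairing G q.1 q.2 ∂(angleGaussPi ι)| ≤ M * (2 * K) := by
  have hp : ∀ i, MemLp (pd i G) 2 (gaussPi ι) := fun i => (hG4 i).mono_exponent (by norm_num)
  have hI := integrable_gradPairing_angle hp
  have hJ : Integrable (fun q : ℝ × ((ι → ℝ) × (ι → ℝ)) => φ q.2.1 * gradPairing G q.1 q.2)
      (angleGaussPi ι) :=
    hI.bdd_mul (hφc.comp (continuous_fst.comp continuous_snd)).aestronglyMeasurable
      (ae_of_all _ fun q => hφ _)
  rw [integral_prod _ hI, integral_prod _ hJ, ← integral_const_mul,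
    ← integral_sub (hI.integral_prod_left.const_mul _) hJ.integral_prod_left]
  have hb : ∀ θ : ℝ, ‖(∫ x, φ x ∂(gaussPi ι)) *
      (∫ p, gradPairing G θ p ∂((gaussPi ι).prod (gaussPi ι))) -
      ∫ p, φ p.1 * gradPairing G θ p ∂((gaussPi ι).prod (gaussPi ι))‖ ≤ M * (2 * K) := by
    intro θ
    have := abs_integral_mul_integral_sub_le (φ := fun p : (ι → ℝ) × (ι → ℝ) => φ p.1) (M := M)
      (μ := (gaussPi ι).prod (gaussPi ι)) (s := 2 * K) (by positivity)
      (hφc.comp continuous_fst).aestronglyMeasurable (fun p => hφ _)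
      (memLp_gradPairing hG4 θ) (variance_gradPairing_le hG hG4 hK θ)
    rwa [integral_comp_measurePreserving measurePreserving_fst hφc.aestronglyMeasurable] at this
  have := norm_integral_le_of_norm_le_const (μ := sinMeasure) (ae_of_all _ hb)
  simpa using this

/-- The second order Poincaré inequality for a function of a standard gaussian vector, tested
against a continuous function with values in `[0, 1]`. -/
theorem abs_integral_comp_sub_integral_gaussianReal_le {G : (ι → ℝ) → ℝ} (hG : ContDiff ℝ 2 G)
    (hG2 : MemLp G 2 (gaussPi ι)) (hG4 : ∀ i, MemLp (pd i G) 4 (gaussPi ι)) {K : ℝ≥0}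
    (hK : HessGradBound G K) (hv : 0 < Var[G; gaussPi ι]) {h : ℝ → ℝ} (hc : Continuous h)
    (h0 : ∀ x, 0 ≤ h x) (h1 : ∀ x, h x ≤ 1) :
    |∫ x, h (G x) ∂(gaussPi ι) -
      ∫ t, h t ∂(gaussianReal (∫ x, G x ∂(gaussPi ι)) (Var[G; gaussPi ι]).toNNReal)| ≤
      4 * K / Var[G; gaussPi ι] := by
  set v := Var[G; gaussPi ι] with hvdef
  set m := ∫ x, G x ∂(gaussPi ι)
  set s := √v with hsdef
  have hs : 0 < s := Real.sqrt_pos.2 hv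
  have hsv : s * s = v := Real.mul_self_sqrt hv.le
  have hp : ∀ i, MemLp (pd i G) 2 (gaussPi ι) := fun i => (hG4 i).mono_exponent (by norm_num)
  have hgauss : ∫ t, h t ∂(gaussianReal m v.toNNReal) =
      ∫ t, h (m + s * t) ∂(gaussianReal 0 1) := by
    have e : gaussianReal m v.toNNReal = (gaussianReal 0 1).map (fun t => m + s * t) := by
      have : (fun t => m + s * t) = (fun t => m + t) ∘ (fun t => s * t) := rfl
      rw [this, ← Measure.map_map (by fun_prop) (by fun_prop), gaussianReal_map_const_mul,
        gaussianReal_map_const_add]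
      congr 1
      · simp
      · ext
        simp [Real.coe_toNNReal _ hv.le, hsdef, Real.sq_sqrt hv.le]
    rw [e, integral_map (by fun_prop) hc.aestronglyMeasurable]
  obtain ⟨f, f', hf, hf'c, hf'b, hst⟩ := exists_stein_solution (h := fun t => h (m + s * t))
    (by fun_prop) (fun _ => h0 _) (fun _ => h1 _)
  have hfc : ContDiff ℝ 1 f := by
    rw [contDiff_one_iff_deriv]
    refine ⟨fun x => (hf x).differentiableAt, ?_⟩
    rwa [funext fun x => (hf x).deriv]
  let w : (ι → ℝ) → ℝ := fun x => (G x - m) / s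
  have hG1 : ContDiff ℝ 1 G := hG.of_le (by norm_num)
  have hw1 : ContDiff ℝ 1 w := (hG1.sub contDiff_const).div_const s
  have hw2 : MemLp w 2 (gaussPi ι) := by
    have := (hG2.sub (memLp_const m)).mul_const s⁻¹
    simpa [w, div_eq_mul_inv] using! this
  have hwd : ∀ x, HasFDerivAt w (s⁻¹ • fderiv ℝ G x) x := fun x => by
    have := ((hG1.differentiable one_ne_zero x).hasFDerivAt.sub_const m).mul_const s⁻¹
    simpa [w, div_eq_mul_inv] using this
  -- A bounded derivative gives linear growth, so `f ∘ w` is square integrable because `w` is.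
  have hflip : ∀ t, |f t| ≤ |f 0| + 2 * |t| := fun t => by
    have := convex_univ.norm_image_sub_le_of_norm_hasDerivWithin_le (f := f) (f' := f') (C := 2)
      (fun x _ => (hf x).hasDerivWithinAt) (fun x _ => hf'b x) (Set.mem_univ 0) (Set.mem_univ t)
    rw [sub_zero, Real.norm_eq_abs, Real.norm_eq_abs] at this
    have h2 := abs_sub_abs_le_abs_sub (f t) (f 0)
    linarith
  let F : (ι → ℝ) → ℝ := fun x => f (w x)
  have hF1 : ContDiff ℝ 1 F := hfc.comp hw1
  have hF2 : MemLp F 2 (gaussPi ι) := by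
    refine ((memLp_const |f 0|).add (hw2.norm.const_mul 2)).mono'
      hF1.continuous.aestronglyMeasurable (ae_of_all _ fun x => hflip _)
  have hpdF : ∀ i x, pd i F x = f' (w x) * (s⁻¹ * pd i G x) := fun i x => by
    have := (hf (w x)).hasFDerivAt.comp x (hwd x)
    rw [pd]
    erw [this.fderiv]
    simp [pd]
    ring
  let φ : (ι → ℝ) → ℝ := fun x => f' (w x)
  have hφc : Continuous φ := hf'c.comp hw1.continuous
  have hφb : ∀ x, |φ x| ≤ 2 := fun x => hf'b _
  have hpdF2 : ∀ i, MemLp (pd i F) 2 (gaussPi ι) := fun i => by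
    refine ((hp i).norm.const_mul (2 * s⁻¹)).mono' (continuous_pd hF1 i).aestronglyMeasurable
      (ae_of_all _ fun x => ?_)
    rw [hpdF, norm_mul, norm_mul, Real.norm_of_nonneg (inv_nonneg.2 hs.le), mul_assoc]
    exact mul_le_mul_of_nonneg_right (hφb x) (by positivity)
  have cov1 := covariance_formula hF1 hG1 hF2 hG2 hpdF2 hp
  have e1 : ∀ q : ℝ × ((ι → ℝ) × (ι → ℝ)), ∑ i, pd i F q.2.1 * pd i G (mix q.1 q.2) =
      s⁻¹ * (φ q.2.1 * gradPairing G q.1 q.2) := fun q => by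
    rw [gradPairing, Finset.mul_sum, Finset.mul_sum]
    refine Finset.sum_congr rfl fun i _ => ?_
    rw [hpdF]; ring
  simp only [e1, integral_const_mul] at cov1
  have cov2 : v = ∫ q, gradPairing G q.1 q.2 ∂(angleGaussPi ι) := by
    have := covariance_formula hG1 hG1 hG2 hG2 hp hp
    rw [hvdef, variance_eq_sub hG2]
    simp only [Pi.pow_apply, sq]
    exact this
  have hint1 : Integrable (fun x => h (G x)) (gaussPi ι) :=
    .of_bound (hc.comp hG.continuous).aestronglyMeasurable 1 (ae_of_all _ fun x => by
      rw [Real.norm_of_nonneg (h0 _)]; exact h1 _)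
  have hφi : Integrable φ (gaussPi ι) := .of_bound hφc.aestronglyMeasurable 2 (ae_of_all _ hφb)
  have hwF : Integrable (fun x => w x * F x) (gaussPi ι) := hw2.integrable_mul hF2
  have hFi := hF2.integrable one_le_two
  have hFG : Integrable (fun x => F x * G x) (gaussPi ι) := hF2.integrable_mul hG2
  have e2 : ∫ x, w x * F x ∂(gaussPi ι) =
      s⁻¹ * (∫ x, F x * G x ∂(gaussPi ι) - (∫ x, F x ∂(gaussPi ι)) * m) := by
    rw [← integral_mul_const, ← integral_sub hFG (hFi.mul_const m), ← integral_const_mul]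
    congr 1; ext x
    simp only [w]; ring
  have e3 : ∫ x, h (G x) ∂(gaussPi ι) - ∫ t, h (m + s * t) ∂(gaussianReal 0 1) =
      ∫ x, φ x ∂(gaussPi ι) - ∫ x, w x * F x ∂(gaussPi ι) := by
    rw [← integral_sub hφi hwF]
    have : ∀ x, φ x - w x * F x = h (G x) - ∫ t, h (m + s * t) ∂(gaussianReal 0 1) := fun x => by
      have := hst (w x)
      have e : m + s * w x = G x := by simp only [w]; field_simp; ring
      rw [e] at this
      exact this
    simp only [this]
    rw [integral_sub hint1 (integrable_const _)]
    simp
  have key := abs_integral_gradPairing_le hG hG4 hK hφc hφb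
  rw [← cov2] at key
  -- After multiplication by `v = s²`, the two factors `s⁻¹`, from standardizing `G` and from
  -- differentiating `f ∘ w`, cancel and leave the quantity bounded in `key` with `M = 2`.
  rw [hgauss, e3, e2, cov1, le_div_iff₀ hv,
    show ∀ a : ℝ, |a| * v = |a * v| from fun a => by rw [abs_mul, abs_of_pos hv]]
  refine le_trans (le_of_eq ?_) (key.trans (by linarith))
  congr 1
  rw [sub_mul, ← hsv]
  field_simp

theorem tvDist_map_gaussPi_le {G : (ι → ℝ) → ℝ} (hG : ContDiff ℝ 2 G)
    (hG2 : MemLp G 2 (gaussPi ι)) (hG4 : ∀ i, MemLp (pd i G) 4 (gaussPi ι)) {K : ℝ≥0}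
    (hK : HessGradBound G K) (hv : 0 < Var[G; gaussPi ι]) :
    tvDist ((gaussPi ι).map G)
      (gaussianReal (∫ x, G x ∂(gaussPi ι)) (Var[G; gaussPi ι]).toNNReal) ≤
      ENNReal.ofReal (4 * K / Var[G; gaussPi ι]) := by
  have : IsProbabilityMeasure ((gaussPi ι).map G) :=
    Measure.isProbabilityMeasure_map hG.continuous.aemeasurable
  refine tvDist_le_of_forall_continuous fun h hc h0 h1 => ?_
  rw [integral_map hG.continuous.aemeasurable hc.aestronglyMeasurable]
  exact abs_integral_comp_sub_integral_gaussianReal_le hG hG2 hG4 hK hv hc h0 h1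

end

/-! ### Derivatives on Euclidean space, the moments `κ₀`, `κ₁`, `κ₂`, and integrability. -/

section

variable {n : ℕ}

lemma contDiff_partialDeriv {g : EuclideanSpace ℝ (Fin n) → ℝ} (hg : ContDiff ℝ 2 g) (i : Fin n) :
    ContDiff ℝ 1 (partialDeriv i g) :=
  (hg.fderiv_right (m := 1) (by norm_num)).clm_apply contDiff_const

lemma continuous_hessian_apply {g : EuclideanSpace ℝ (Fin n) → ℝ} (hg : ContDiff ℝ 2 g)
    (i j : Fin n) : Continuous fun x => hessian g x i j :=
  ((contDiff_partialDeriv hg j).continuous_fderiv one_ne_zero).clm_apply continuous_const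

lemma continuous_opNorm_hessian {g : EuclideanSpace ℝ (Fin n) → ℝ} (hg : ContDiff ℝ 2 g) :
    Continuous fun x => opNorm (hessian g x) := by
  have h1 : Continuous fun x => hessian g x :=
    continuous_pi fun i => continuous_pi fun j => continuous_hessian_apply hg i j
  have h2 : Continuous fun A : Matrix (Fin n) (Fin n) ℝ =>
      Matrix.toEuclideanCLM (n := Fin n) (𝕜 := ℝ) A :=
    LinearMap.continuous_of_finiteDimensional
      (Matrix.toEuclideanCLM (n := Fin n) (𝕜 := ℝ)).toAlgEquiv.toLinearMap
  exact (h2.comp h1).enorm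

lemma gradient_apply {g : EuclideanSpace ℝ (Fin n) → ℝ} (x : EuclideanSpace ℝ (Fin n))
    (i : Fin n) : gradient g x i = partialDeriv i g x := by
  rw [partialDeriv, ← inner_gradient_left, EuclideanSpace.inner_single_right]
  simp

lemma continuous_gradient {g : EuclideanSpace ℝ (Fin n) → ℝ} (hg : ContDiff ℝ 2 g) :
    Continuous (gradient g) :=
  (InnerProductSpace.toDual ℝ (EuclideanSpace ℝ (Fin n))).symm.continuous.comp
    (hg.continuous_fderiv two_ne_zero)

lemma enorm_partialDeriv_le (g : EuclideanSpace ℝ (Fin n) → ℝ) (x : EuclideanSpace ℝ (Fin n))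
    (i : Fin n) : ‖partialDeriv i g x‖ₑ ≤ ‖gradient g x‖ₑ := by
  rw [← gradient_apply, enorm_le_iff_norm_le]
  exact PiLp.norm_apply_le _ i

/-- The chain rule in coordinates. -/
lemma pd_comp {U : (Fin n → ℝ) → EuclideanSpace ℝ (Fin n)} (hU : ContDiff ℝ 1 U)
    {f : EuclideanSpace ℝ (Fin n) → ℝ} (hf : ContDiff ℝ 1 f) (i : Fin n) (x : Fin n → ℝ) :
    pd i (fun x => f (U x)) x = ∑ k, pd i (fun x => U x k) x * partialDeriv k f (U x) := by
  have hUd := (hU.differentiable one_ne_zero x).hasFDerivAt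
  have h := (hf.differentiable one_ne_zero (U x)).hasFDerivAt.comp x hUd
  have hk : ∀ k, pd i (fun x => U x k) x = fderiv ℝ U x (Pi.single i 1) k := fun k => by
    have := (EuclideanSpace.proj k : StrongDual ℝ (EuclideanSpace ℝ (Fin n))).hasFDerivAt.comp x hUd
    rw [pd]
    erw [this.fderiv]
    rfl
  rw [pd]
  erw [h.fderiv]
  rw [ContinuousLinearMap.comp_apply]
  set v := fderiv ℝ U x (Pi.single i 1)
  have hv : v = ∑ k, v k • EuclideanSpace.single k (1 : ℝ) := by
    ext j
    simp [Finset.sum_apply, Pi.single_apply]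
  rw [hv, map_sum]
  refine Finset.sum_congr rfl fun k _ => ?_
  rw [map_smul, smul_eq_mul, hk]
  rfl

/-- Full support turns almost everywhere equality of continuous functions into equality everywhere.
-/
instance isOpenPosMeasure_gaussPi : (gaussPi (Fin n)).IsOpenPosMeasure := by
  have : (gaussianReal 0 1).IsOpenPosMeasure :=
    (gaussianReal_absolutelyContinuous' 0 one_ne_zero).isOpenPosMeasure
  infer_instance

lemma kappa0_sq {Ω : Type*} [MeasurableSpace Ω] (P : Measure Ω)
    (X : Ω → EuclideanSpace ℝ (Fin n)) (g : EuclideanSpace ℝ (Fin n) → ℝ) :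
    kappa0 P X g ^ 2 = ∫⁻ ω, ∑ i, ‖partialDeriv i g (X ω)‖ₑ ^ 4 ∂P := by
  rw [kappa0, ← ENNReal.rpow_ofNat, ← ENNReal.rpow_mul]
  norm_num

lemma kappa1_pow_four {Ω : Type*} [MeasurableSpace Ω] (P : Measure Ω)
    (X : Ω → EuclideanSpace ℝ (Fin n)) (g : EuclideanSpace ℝ (Fin n) → ℝ) :
    kappa1 P X g ^ 4 = ∫⁻ ω, ‖gradient g (X ω)‖ₑ ^ 4 ∂P := by
  rw [kappa1, ← ENNReal.rpow_ofNat, ← ENNReal.rpow_mul]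
  norm_num

lemma kappa2_pow_four {Ω : Type*} [MeasurableSpace Ω] (P : Measure Ω)
    (X : Ω → EuclideanSpace ℝ (Fin n)) (g : EuclideanSpace ℝ (Fin n) → ℝ) :
    kappa2 P X g ^ 4 = ∫⁻ ω, opNorm (hessian g (X ω)) ^ 4 ∂P := by
  rw [kappa2, ← ENNReal.rpow_ofNat, ← ENNReal.rpow_mul]
  norm_num

lemma lintegral_comp_eq_of_map_eq {Ω Ω' E : Type*} [MeasurableSpace Ω] [MeasurableSpace Ω']
    [MeasurableSpace E] {P : Measure Ω} {P' : Measure Ω'} {X : Ω → E} {Y : Ω' → E}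
    (hX : AEMeasurable X P) (hY : AEMeasurable Y P') (h : P.map X = P'.map Y) {f : E → ℝ≥0∞}
    (hf : Measurable f) : ∫⁻ ω, f (X ω) ∂P = ∫⁻ ω, f (Y ω) ∂P' := by
  rw [← lintegral_map' hf.aemeasurable hX, h, lintegral_map' hf.aemeasurable hY]

section

variable {Ω Ω' : Type*} [MeasurableSpace Ω] [MeasurableSpace Ω'] {P : Measure Ω} {P' : Measure Ω'}
  {X : Ω → EuclideanSpace ℝ (Fin n)} {Y : Ω' → EuclideanSpace ℝ (Fin n)}
  {g : EuclideanSpace ℝ (Fin n) → ℝ}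

lemma kappa0_congr (hX : AEMeasurable X P) (hY : AEMeasurable Y P') (h : P.map X = P'.map Y)
    (hg : ContDiff ℝ 2 g) : kappa0 P X g = kappa0 P' Y g := by
  rw [kappa0, kappa0, lintegral_comp_eq_of_map_eq hX hY h
    (f := fun x => ∑ i, ‖partialDeriv i g x‖ₑ ^ 4)]
  exact Finset.measurable_sum _ fun i _ =>
    (contDiff_partialDeriv hg i).continuous.measurable.enorm.pow_const 4

lemma kappa1_congr (hX : AEMeasurable X P) (hY : AEMeasurable Y P') (h : P.map X = P'.map Y)
    (hg : ContDiff ℝ 2 g) : kappa1 P X g = kappa1 P' Y g := by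
  rw [kappa1, kappa1, lintegral_comp_eq_of_map_eq hX hY h (f := fun x => ‖gradient g x‖ₑ ^ 4)]
  exact (continuous_gradient hg).measurable.enorm.pow_const 4

lemma kappa2_congr (hX : AEMeasurable X P) (hY : AEMeasurable Y P') (h : P.map X = P'.map Y)
    (hg : ContDiff ℝ 2 g) : kappa2 P X g = kappa2 P' Y g := by
  rw [kappa2, kappa2, lintegral_comp_eq_of_map_eq hX hY h
    (f := fun x => opNorm (hessian g x) ^ 4)]
  exact (continuous_opNorm_hessian hg).measurable.pow_const 4

end

section

variable {U : (Fin n → ℝ) → EuclideanSpace ℝ (Fin n)} {g : EuclideanSpace ℝ (Fin n) → ℝ}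
  {α : Type*} [MeasurableSpace α] {μ : Measure α} {u v : α → (Fin n → ℝ)}

/-- The Cauchy–Schwarz inequality separates the two factors, so only the marginal laws of `u` and
`v` matter, not their dependence. -/
lemma lintegral_opNorm_mul_gradient_le (hU : ContDiff ℝ 2 U) (hg : ContDiff ℝ 2 g)
    (hu : MeasurePreserving u μ (gaussPi (Fin n))) (hv : MeasurePreserving v μ (gaussPi (Fin n))) :
    ∫⁻ p, (opNorm (hessian g (U (u p))) * ‖gradient g (U (v p))‖ₑ) ^ 2 ∂μ ≤
      (kappa1 (gaussPi (Fin n)) U g * kappa2 (gaussPi (Fin n)) U g) ^ 2 := by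
  have hm1 : Measurable fun x => opNorm (hessian g (U x)) :=
    ((continuous_opNorm_hessian hg).comp hU.continuous).measurable
  have hm2 : Measurable fun x => ‖gradient g (U x)‖ₑ :=
    ((continuous_gradient hg).comp hU.continuous).measurable.enorm
  have h := ENNReal.lintegral_mul_le_Lp_mul_Lq μ Real.HolderConjugate.two_two
    ((hm1.comp hu.measurable).pow_const 2).aemeasurable
    ((hm2.comp hv.measurable).pow_const 2).aemeasurable
  have e1 : ∫⁻ p, opNorm (hessian g (U (u p))) ^ 4 ∂μ = kappa2 (gaussPi (Fin n)) U g ^ 4 := by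
    rw [kappa2_pow_four]
    exact hu.lintegral_comp (hm1.pow_const 4)
  have e2 : ∫⁻ p, ‖gradient g (U (v p))‖ₑ ^ 4 ∂μ = kappa1 (gaussPi (Fin n)) U g ^ 4 := by
    rw [kappa1_pow_four]
    exact hv.lintegral_comp (hm2.pow_const 4)
  have e3 : ∀ a : ℝ≥0∞, (a ^ 4) ^ (1 / 2 : ℝ) = a ^ 2 := fun a => by
    rw [← ENNReal.rpow_ofNat, ← ENNReal.rpow_mul, ← ENNReal.rpow_ofNat]
    norm_num
  simp only [Function.comp, Pi.mul_apply, ENNReal.rpow_ofNat, ← pow_mul, Nat.reduceMul, e1, e2,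
    e3] at h
  simp only [mul_pow]
  rwa [mul_comm (kappa1 _ _ _ ^ 2)]

/-- By `2 (ab)² ≤ a⁴ + b⁴` in each coordinate, again only the marginal laws enter. -/
lemma lintegral_sum_sq_mul_sq_le (hU : ContDiff ℝ 2 U) (hg : ContDiff ℝ 2 g)
    (hu : MeasurePreserving u μ (gaussPi (Fin n))) (hv : MeasurePreserving v μ (gaussPi (Fin n))) :
    ∫⁻ p, ∑ i, (‖partialDeriv i g (U (u p))‖ₑ * ‖partialDeriv i g (U (v p))‖ₑ) ^ 2 ∂μ ≤
      kappa0 (gaussPi (Fin n)) U g ^ 2 := by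
  have hm : Measurable fun x => ∑ i, ‖partialDeriv i g (U x)‖ₑ ^ 4 :=
    Finset.measurable_sum _ fun i _ =>
      ((contDiff_partialDeriv hg i).continuous.comp hU.continuous).measurable.enorm.pow_const 4
  have e : ∀ {w : α → (Fin n → ℝ)}, MeasurePreserving w μ (gaussPi (Fin n)) →
      ∫⁻ p, ∑ i, ‖partialDeriv i g (U (w p))‖ₑ ^ 4 ∂μ = kappa0 (gaussPi (Fin n)) U g ^ 2 :=
    fun hw => by
      rw [kappa0_sq]
      exact hw.lintegral_comp hm
  have hle : ∀ a b : ℝ≥0∞, 2 * (a * b) ^ 2 ≤ a ^ 4 + b ^ 4 := fun a b => by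
    rcases eq_or_ne a ⊤ with rfl | ha
    · simp
    rcases eq_or_ne b ⊤ with rfl | hb
    · simp
    lift a to ℝ≥0 using ha
    lift b to ℝ≥0 using hb
    norm_cast
    rw [← NNReal.coe_le_coe]
    push_cast
    nlinarith [sq_nonneg ((a : ℝ) ^ 2 - (b : ℝ) ^ 2)]
  have h2 : 2 * ∫⁻ p, ∑ i, (‖partialDeriv i g (U (u p))‖ₑ *
      ‖partialDeriv i g (U (v p))‖ₑ) ^ 2 ∂μ ≤ 2 * kappa0 (gaussPi (Fin n)) U g ^ 2 := by
    rw [← lintegral_const_mul' _ _ ENNReal.ofNat_ne_top, two_mul (kappa0 _ _ _ ^ 2)]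
    nth_rw 1 [← e hu]
    rw [← e hv]
    refine le_trans (lintegral_mono fun p => ?_)
      (lintegral_add_left (hm.comp hu.measurable) _).le
    simp only [Finset.mul_sum, Function.comp]
    rw [← Finset.sum_add_distrib]
    exact Finset.sum_le_sum fun i _ => hle _ _
  exact (ENNReal.mul_le_mul_iff_right two_ne_zero ENNReal.ofNat_ne_top).1 h2

lemma eq_zero_of_opNorm_eq_zero {A : Matrix (Fin n) (Fin n) ℝ} (h : opNorm A = 0) : A = 0 := by
  have h1 : ‖Matrix.toEuclideanCLM (n := Fin n) (𝕜 := ℝ) A‖ = 0 := by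
    rw [← toReal_enorm]
    exact (congrArg ENNReal.toReal h).trans ENNReal.toReal_zero
  exact (map_eq_zero_iff _ (Matrix.toEuclideanCLM (n := Fin n) (𝕜 := ℝ)).injective).1
    (norm_eq_zero.1 h1)

/-- If `κ₂ = 0`, the Hessian vanishes on the image of `U`. -/
lemma hessian_eq_zero_of_kappa2_eq_zero (hU : ContDiff ℝ 2 U) (hg : ContDiff ℝ 2 g)
    (h : kappa2 (gaussPi (Fin n)) U g = 0) (x : Fin n → ℝ) : hessian g (U x) = 0 := by
  have hc : Continuous fun x => opNorm (hessian g (U x)) :=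
    (continuous_opNorm_hessian hg).comp hU.continuous
  have h4 := kappa2_pow_four (gaussPi (Fin n)) U g
  rw [h, zero_pow four_ne_zero, eq_comm, lintegral_eq_zero_iff (hc.measurable.pow_const 4)] at h4
  have h5 : (fun x => opNorm (hessian g (U x))) =ᵐ[gaussPi (Fin n)] fun _ => 0 :=
    h4.mono fun x hx => by simpa using hx
  have h6 := congrFun (Continuous.ae_eq_iff_eq _ hc continuous_const |>.1 h5) x
  exact eq_zero_of_opNorm_eq_zero h6

/-- Finiteness of a product containing `κ₁ κ₂` leaves open `κ₁ = ∞` with `κ₂ = 0`. In that case the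
Hessian vanishes on the image of `U`, and the partial derivatives of `g` are constant along `U`. -/
lemma memLp_partialDeriv_comp (hU : ContDiff ℝ 2 U) (hg : ContDiff ℝ 2 g)
    (h : kappa1 (gaussPi (Fin n)) U g ≠ ⊤ ∨ kappa2 (gaussPi (Fin n)) U g = 0) (k : Fin n) :
    MemLp (fun x => partialDeriv k g (U x)) 4 (gaussPi (Fin n)) := by
  have hc := (contDiff_partialDeriv hg k).continuous.comp hU.continuous
  rcases h with h | h
  · refine ⟨hc.aestronglyMeasurable, ?_⟩
    rw [eLpNorm_lt_top_iff_lintegral_rpow_enorm_lt_top (by norm_num) ENNReal.ofNat_ne_top]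
    simp only [ENNReal.toReal_ofNat, ENNReal.rpow_ofNat]
    refine (lintegral_mono fun x => ?_).trans_lt
      ((kappa1_pow_four (gaussPi (Fin n)) U g).symm.trans_lt
        (ENNReal.pow_lt_top (lt_top_iff_ne_top.2 h)))
    exact pow_le_pow_left' (enorm_partialDeriv_le g (U x) k) 4
  · have hU1 : ContDiff ℝ 1 U := hU.of_le (by norm_num)
    have hd : ContDiff ℝ 1 fun x => partialDeriv k g (U x) :=
      (contDiff_partialDeriv hg k).comp hU1
    have h0 : ∀ x, fderiv ℝ (fun x => partialDeriv k g (U x)) x = 0 := fun x => by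
      ext y
      rw [fderiv_apply_eq_sum_pd]
      simp only [pd_comp hU1 (contDiff_partialDeriv hg k)]
      have : ∀ l, partialDeriv l (partialDeriv k g) (U x) = 0 := fun l =>
        congrFun (congrFun (hessian_eq_zero_of_kappa2_eq_zero hU hg h x) l) k
      simp [this]
    have : (fun x => partialDeriv k g (U x)) = fun _ => partialDeriv k g (U 0) :=
      funext fun x => is_const_of_fderiv_eq_zero (hd.differentiable one_ne_zero) h0 x 0
    rw [this]
    exact memLp_const _

lemma memLp_pd_comp (hU : ContDiff ℝ 2 U) (hg : ContDiff ℝ 2 g) {C : ℝ}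
    (hC : ∀ i k x, ‖pd i (fun x => U x k) x‖ ≤ C)
    (h : kappa1 (gaussPi (Fin n)) U g ≠ ⊤ ∨ kappa2 (gaussPi (Fin n)) U g = 0) (i : Fin n) :
    MemLp (pd i fun x => g (U x)) 4 (gaussPi (Fin n)) := by
  have hU1 : ContDiff ℝ 1 U := hU.of_le (by norm_num)
  have e : (pd i fun x => g (U x)) = fun x => ∑ k, pd i (fun x => U x k) x *
      partialDeriv k g (U x) := funext fun x => pd_comp hU1 (hg.of_le (by norm_num)) i x
  rw [e]
  refine memLp_finsetSum _ fun k _ => ?_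
  have hUk : ContDiff ℝ 1 fun x => U x k :=
    (EuclideanSpace.proj k : StrongDual ℝ (EuclideanSpace ℝ (Fin n))).contDiff.comp hU1
  refine (memLp_partialDeriv_comp hU hg h k).of_le_mul (c := C) ((continuous_pd hUk i).mul
    ((contDiff_partialDeriv hg k).continuous.comp hU.continuous)).aestronglyMeasurable
    (ae_of_all _ fun x => ?_)
  rw [norm_mul]
  exact mul_le_mul_of_nonneg_right (hC i k x) (norm_nonneg _)

end

end

/-! ### Transfer from `g(X)` to `g ∘ U`, and norm inequalities. -/

section

variable {n : ℕ}

lemma tvDist_self (μ : Measure ℝ) : tvDist μ μ = 0 := by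
  simp [tvDist]

/-- The total variation bound for `g(X)`, where `X` has the law of `U` under the standard gaussian
measure, in terms of a bound `R` for the second order quantity of `g ∘ U`. -/
theorem dTV_le_of_hessGradBound {Ω Ω' : Type*} [MeasurableSpace Ω] [MeasurableSpace Ω']
    {P : Measure Ω} [IsProbabilityMeasure P] {P' : Measure Ω'}
    {X : Ω → EuclideanSpace ℝ (Fin n)} (hX : AEMeasurable X P)
    {g : EuclideanSpace ℝ (Fin n) → ℝ} (hg : ContDiff ℝ 2 g)
    (hW4 : MemLp (fun ω => g (X ω)) 4 P) {Z : Ω' → ℝ}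
    (hZ : HasLaw Z (gaussianReal (∫ ω, g (X ω) ∂P) (Var[fun ω => g (X ω); P]).toNNReal) P')
    {U : (Fin n → ℝ) → EuclideanSpace ℝ (Fin n)} (hU : ContDiff ℝ 2 U)
    (hlaw : P.map X = (gaussPi (Fin n)).map U) {R : ℝ≥0∞}
    (h4 : R ≠ ⊤ → ∀ i, MemLp (pd i fun x => g (U x)) 4 (gaussPi (Fin n)))
    (hR : R ≠ ⊤ → HessGradBound (fun x => g (U x)) R.toNNReal) :
    dTV (fun ω => g (X ω)) P Z P' ≤
      2 * ENNReal.ofReal (Real.sqrt 5) * R / ENNReal.ofReal (Var[fun ω => g (X ω); P]) := by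
  have hUm : AEMeasurable U (gaussPi (Fin n)) := hU.continuous.aemeasurable
  have hgm : Measurable g := hg.continuous.measurable
  have hG : ContDiff ℝ 2 fun x => g (U x) := hg.comp hU
  have hmap : P.map (fun ω => g (X ω)) = (gaussPi (Fin n)).map fun x => g (U x) := by
    have e1 : (fun ω => g (X ω)) = g ∘ X := rfl
    have e2 : (fun x => g (U x)) = g ∘ U := rfl
    rw [e1, e2, ← AEMeasurable.map_map_of_aemeasurable hgm.aemeasurable hX,
      ← AEMeasurable.map_map_of_aemeasurable hgm.aemeasurable hUm, hlaw]
  have hmean : ∫ ω, g (X ω) ∂P = ∫ x, g (U x) ∂(gaussPi (Fin n)) := by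
    rw [← integral_map hX hgm.aestronglyMeasurable, hlaw,
      integral_map hUm hgm.aestronglyMeasurable]
  have hvar : Var[fun ω => g (X ω); P] = Var[fun x => g (U x); gaussPi (Fin n)] := by
    have e1 := variance_map (X := g) (Y := X) hgm.aemeasurable hX
    have e2 := variance_map (X := g) (Y := U) hgm.aemeasurable hUm
    rw [hlaw] at e1
    exact e1.symm.trans e2
  rw [dTV, hZ.map_eq]
  -- If the variance is zero, `W` is almost surely its mean and both laws are the same Dirac mass.
  rcases (variance_nonneg (fun ω => g (X ω)) P).eq_or_lt with hv | hv
  · have hW2 : MemLp (fun ω => g (X ω)) 2 P := hW4.mono_exponent (by norm_num)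
    have h0 : evariance (fun ω => g (X ω)) P = 0 := by
      rw [← hW2.ofReal_variance_eq, ← hv, ENNReal.ofReal_zero]
    rw [evariance_eq_zero_iff hW2.aemeasurable] at h0
    have : P.map (fun ω => g (X ω)) = Measure.dirac (∫ ω, g (X ω) ∂P) := by
      rw [Measure.map_congr h0, Measure.map_const, measure_univ, one_smul]
    rw [this, ← hv, Real.toNNReal_zero, gaussianReal_zero_var, tvDist_self]
    exact zero_le
  rcases eq_or_ne R ⊤ with hR' | hR'
  · rw [hR', ENNReal.mul_top, ENNReal.top_div_of_ne_top ENNReal.ofReal_ne_top]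
    · exact le_top
    · simp
  · have hG2 : MemLp (fun x => g (U x)) 2 (gaussPi (Fin n)) := by
      have h1 := (memLp_map_measure_iff (p := 2) hgm.aestronglyMeasurable hX).2
        (hW4.mono_exponent (by norm_num) : MemLp (g ∘ X) 2 P)
      rw [hlaw] at h1
      exact (memLp_map_measure_iff (p := 2) hgm.aestronglyMeasurable hUm).1 h1
    rw [hmap, hmean]
    rw [hvar] at hv ⊢
    refine (tvDist_map_gaussPi_le hG hG2 (h4 hR') (hR hR') hv).trans ?_
    rw [ENNReal.ofReal_div_of_pos hv]
    refine ENNReal.div_le_div_right ?_ _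
    lift R to ℝ≥0 using hR'
    rw [ENNReal.toNNReal_coe, ENNReal.ofReal_mul (by norm_num), ENNReal.ofReal_coe_nnreal]
    gcongr
    have : (2 : ℝ≥0∞) = ENNReal.ofReal 2 := by simp
    rw [this, ← ENNReal.ofReal_mul (by norm_num)]
    refine ENNReal.ofReal_le_ofReal ?_
    -- The argument yields the constant `4`, which is below `2√5`.
    have : (2 : ℝ) ≤ √5 := Real.le_sqrt_of_sq_le (by norm_num)
    linarith

/-- Minkowski's inequality in `L²`, written with squares to avoid roots. -/
lemma lintegral_add_sq_le {α : Type*} [MeasurableSpace α] {μ : Measure α} {f h : α → ℝ≥0∞}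
    (hf : Measurable f) (hh : Measurable h) {a b : ℝ≥0∞} (ha : ∫⁻ x, f x ^ 2 ∂μ ≤ a ^ 2)
    (hb : ∫⁻ x, h x ^ 2 ∂μ ≤ b ^ 2) : ∫⁻ x, (f x + h x) ^ 2 ∂μ ≤ (a + b) ^ 2 := by
  have key := ENNReal.lintegral_Lp_add_le (μ := μ) hf.aemeasurable hh.aemeasurable
    (p := 2) one_le_two
  simp only [Pi.add_apply, ENNReal.rpow_ofNat] at key
  have hs : ∀ {c d : ℝ≥0∞}, c ≤ d ^ 2 → c ^ (1 / 2 : ℝ) ≤ d := fun {c d} h => by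
    rw [← ENNReal.rpow_ofNat] at h
    have := ENNReal.rpow_le_rpow h (z := 1 / 2) (by norm_num)
    rwa [← ENNReal.rpow_mul, show ((2 : ℝ) * (1 / 2)) = 1 by norm_num, ENNReal.rpow_one] at this
  have h2 := pow_le_pow_left' (key.trans (add_le_add (hs ha) (hs hb))) 2
  rwa [← ENNReal.rpow_ofNat, ← ENNReal.rpow_mul, show ((1 / 2 : ℝ) * 2) = 1 by norm_num,
    ENNReal.rpow_one] at h2

lemma enorm_sq_toLp (w : Fin n → ℝ) : ‖WithLp.toLp 2 w‖ₑ ^ 2 = ∑ i, ‖w i‖ₑ ^ 2 := by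
  simp only [← ofReal_norm, ← ENNReal.ofReal_pow (norm_nonneg _)]
  rw [EuclideanSpace.norm_sq_eq, ENNReal.ofReal_sum_of_nonneg fun _ _ => sq_nonneg _]

lemma enorm_toLp_mul_le {d : Fin n → ℝ} {c : ℝ≥0} (hd : ∀ i, ‖d i‖ₑ ≤ c)
    (w : EuclideanSpace ℝ (Fin n)) : ‖WithLp.toLp 2 fun i => d i * w i‖ₑ ≤ c * ‖w‖ₑ := by
  have h : ‖WithLp.toLp 2 fun i => d i * w i‖ₑ ^ 2 ≤ (c * ‖w‖ₑ) ^ 2 := by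
    rw [enorm_sq_toLp, mul_pow, show w = WithLp.toLp 2 w.ofLp from rfl, enorm_sq_toLp,
      Finset.mul_sum]
    refine Finset.sum_le_sum fun i _ => ?_
    rw [enorm_mul, mul_pow]
    gcongr
    exact hd i
  exact (ENNReal.pow_le_pow_left_iff two_ne_zero).1 h

lemma enorm_toEuclideanCLM_apply_le (A : Matrix (Fin n) (Fin n) ℝ)
    (w : EuclideanSpace ℝ (Fin n)) :
    ‖Matrix.toEuclideanCLM (n := Fin n) (𝕜 := ℝ) A w‖ₑ ≤ opNorm A * ‖w‖ₑ :=
  (Matrix.toEuclideanCLM (n := Fin n) (𝕜 := ℝ) A).le_opENorm w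

end

section

variable {n : ℕ}

/-! ### Independent coordinates: coordinatewise maps. -/

section Product

/-- The map acting on the `i`-th coordinate by `u i`. -/
noncomputable def coordMap (u : Fin n → ℝ → ℝ) (x : Fin n → ℝ) : EuclideanSpace ℝ (Fin n) :=
  WithLp.toLp 2 fun i => u i (x i)

variable {u : Fin n → ℝ → ℝ} {g : EuclideanSpace ℝ (Fin n) → ℝ}

lemma contDiff_coordMap (hu : ∀ i, ContDiff ℝ 2 (u i)) : ContDiff ℝ 2 (coordMap u) :=
  PiLp.contDiff_toLp.comp (contDiff_pi.2 fun i => (hu i).comp (contDiff_apply ℝ ℝ i))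

lemma pd_comp_eval {f : ℝ → ℝ} (hf : ContDiff ℝ 1 f) (i k : Fin n) (x : Fin n → ℝ) :
    pd i (fun x => f (x k)) x = if i = k then deriv f (x k) else 0 := by
  have h : HasFDerivAt (fun x : Fin n → ℝ => f (x k)) _ x :=
    (hf.differentiable one_ne_zero (x k)).hasDerivAt.hasFDerivAt.comp x
      (ContinuousLinearMap.proj (R := ℝ) (φ := fun _ : Fin n => ℝ) k).hasFDerivAt
  rw [pd, h.fderiv]
  by_cases hik : i = k
  · subst hik; simp
  · simp [hik, Ne.symm hik]

lemma pd_comp_coordMap (hu : ∀ i, ContDiff ℝ 2 (u i)) {f : EuclideanSpace ℝ (Fin n) → ℝ}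
    (hf : ContDiff ℝ 1 f) (j : Fin n) (x : Fin n → ℝ) :
    pd j (fun x => f (coordMap u x)) x =
      deriv (u j) (x j) * partialDeriv j f (coordMap u x) := by
  rw [pd_comp ((contDiff_coordMap hu).of_le (by norm_num)) hf]
  have : ∀ k, pd j (fun x => coordMap u x k) x = if j = k then deriv (u k) (x k) else 0 :=
    fun k => pd_comp_eval ((hu k).of_le (by norm_num)) j k x
  simp only [this, ite_mul, zero_mul, Finset.sum_ite_eq, Finset.mem_univ, if_true]

/-- Since `deriv (u j)` is evaluated at the `j`-th coordinate alone, the second derivatives of `u`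
contribute only on the diagonal. This diagonal term is the source of `κ₀`. -/
lemma pd_pd_comp_coordMap (hu : ∀ i, ContDiff ℝ 2 (u i)) (hg : ContDiff ℝ 2 g) (i j : Fin n)
    (x : Fin n → ℝ) :
    pd i (pd j fun x => g (coordMap u x)) x =
      (if i = j then deriv (deriv (u j)) (x j) * partialDeriv j g (coordMap u x) else 0) +
      deriv (u i) (x i) * hessian g (coordMap u x) i j * deriv (u j) (x j) := by
  have e : (pd j fun x => g (coordMap u x)) =
      fun x => deriv (u j) (x j) * partialDeriv j g (coordMap u x) :=
    funext fun x => pd_comp_coordMap hu (hg.of_le (by norm_num)) j x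
  have hd : ContDiff ℝ 1 (deriv (u j)) :=
    ((contDiff_succ_iff_deriv (n := 1)).1 (by simpa using! hu j)).2.2
  have h1 : ContDiff ℝ 1 fun x : Fin n → ℝ => deriv (u j) (x j) :=
    hd.comp (contDiff_apply ℝ ℝ j)
  have h2 : ContDiff ℝ 1 fun x => partialDeriv j g (coordMap u x) :=
    (contDiff_partialDeriv hg j).comp ((contDiff_coordMap hu).of_le (by norm_num))
  have h3 : pd i (fun x => deriv (u j) (x j) * partialDeriv j g (coordMap u x)) x =
      deriv (u j) (x j) * pd i (fun x => partialDeriv j g (coordMap u x)) x +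
      partialDeriv j g (coordMap u x) * pd i (fun x : Fin n → ℝ => deriv (u j) (x j)) x := by
    rw [pd, fderiv_fun_mul (h1.differentiable one_ne_zero x) (h2.differentiable one_ne_zero x)]
    rfl
  rw [e, h3, pd_comp_coordMap hu (contDiff_partialDeriv hg j), pd_comp_eval hd]
  simp only [hessian, Matrix.of_apply, mul_ite, mul_zero]
  rw [add_comm]
  congr 1
  · congr 1; ring
  · ring

/-- The decomposition of `∇²(g ∘ U)(x) ∇(g ∘ U)(y)` for a coordinatewise map `U`. -/
lemma hessGrad_comp_coordMap (hu : ∀ i, ContDiff ℝ 2 (u i)) (hg : ContDiff ℝ 2 g) (i : Fin n)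
    (x y : Fin n → ℝ) :
    hessGrad (fun x => g (coordMap u x)) i x y =
      deriv (deriv (u i)) (x i) * deriv (u i) (y i) *
        (partialDeriv i g (coordMap u x) * partialDeriv i g (coordMap u y)) +
      deriv (u i) (x i) * Matrix.toEuclideanCLM (n := Fin n) (𝕜 := ℝ)
        (hessian g (coordMap u x)) (WithLp.toLp 2 fun j => deriv (u j) (x j) *
          (WithLp.toLp 2 fun j => deriv (u j) (y j) * gradient g (coordMap u y) j :
            EuclideanSpace ℝ (Fin n)) j) i := by
  rw [hessGrad]
  simp only [pd_pd_comp_coordMap hu hg, pd_comp_coordMap hu (hg.of_le (by norm_num) :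
    ContDiff ℝ 1 g), add_mul, Finset.sum_add_distrib, ite_mul, zero_mul, Finset.sum_ite_eq,
    Finset.mem_univ, if_true, Matrix.toEuclideanCLM_toLp, Matrix.mulVec, dotProduct,
    Finset.mul_sum, gradient_apply]
  congr 1
  · ring
  · exact Finset.sum_congr rfl fun j _ => by ring

variable {c₁ c₂ : ℝ≥0}

lemma enorm_le_of_abs_le {a : ℝ} {c : ℝ≥0} (h : |a| ≤ c) : ‖a‖ₑ ≤ c := by
  rw [← ofReal_norm, ← ENNReal.ofReal_coe_nnreal]
  exact ENNReal.ofReal_le_ofReal h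

/-- The diagonal part carries one first and one second derivative of `u`, hence `c₁c₂`. The
remaining part is the Hessian of `g` multiplied by three diagonal matrices of first derivatives, two
around it and one from the gradient, hence `c₁³`. -/
lemma sum_enorm_hessGrad_coordMap_le (hu : ∀ i, ContDiff ℝ 2 (u i))
    (h1 : ∀ i x, |deriv (u i) x| ≤ c₁) (h2 : ∀ i x, |deriv (deriv (u i)) x| ≤ c₂)
    (hg : ContDiff ℝ 2 g) (x y : Fin n → ℝ) :
    ∑ i, ‖hessGrad (fun x => g (coordMap u x)) i x y‖ₑ ^ 2 ≤
      (c₁ * c₂ * (∑ i, (‖partialDeriv i g (coordMap u x)‖ₑ *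
          ‖partialDeriv i g (coordMap u y)‖ₑ) ^ 2) ^ (1 / 2 : ℝ) +
        c₁ ^ 3 * (opNorm (hessian g (coordMap u x)) * ‖gradient g (coordMap u y)‖ₑ)) ^ 2 := by
  set a : EuclideanSpace ℝ (Fin n) := WithLp.toLp 2 fun i =>
    deriv (deriv (u i)) (x i) * deriv (u i) (y i) *
        (partialDeriv i g (coordMap u x) * partialDeriv i g (coordMap u y)) with ha
  set z : EuclideanSpace ℝ (Fin n) := WithLp.toLp 2 fun j => deriv (u j) (x j) *
          (WithLp.toLp 2 fun j => deriv (u j) (y j) * gradient g (coordMap u y) j :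
            EuclideanSpace ℝ (Fin n)) j
  set b : EuclideanSpace ℝ (Fin n) := WithLp.toLp 2 fun i => deriv (u i) (x i) *
    Matrix.toEuclideanCLM (n := Fin n) (𝕜 := ℝ) (hessian g (coordMap u x)) z i
  have e : ∑ i, ‖hessGrad (fun x => g (coordMap u x)) i x y‖ₑ ^ 2 = ‖a + b‖ₑ ^ 2 := by
    rw [← enorm_sq_toLp]
    congr 2
    ext i
    exact hessGrad_comp_coordMap hu hg i x y
  rw [e]
  refine pow_le_pow_left' ((enorm_add_le a b).trans (add_le_add ?_ ?_)) 2
  · refine (ENNReal.pow_le_pow_left_iff two_ne_zero).1 ?_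
    rw [ha, enorm_sq_toLp, mul_pow, ← ENNReal.rpow_ofNat (_ ^ (1 / 2 : ℝ)), ← ENNReal.rpow_mul]
    norm_num
    rw [Finset.mul_sum]
    refine Finset.sum_le_sum fun i _ => ?_
    rw [← mul_pow]
    refine pow_le_pow_left' (mul_le_mul' ?_ le_rfl) 2
    rw [mul_comm (c₁ : ℝ≥0∞)]
    exact mul_le_mul' (enorm_le_of_abs_le (h2 i _)) (enorm_le_of_abs_le (h1 i _))
  · calc ‖b‖ₑ ≤ c₁ * ‖Matrix.toEuclideanCLM (n := Fin n) (𝕜 := ℝ)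
            (hessian g (coordMap u x)) z‖ₑ :=
          enorm_toLp_mul_le (fun i => enorm_le_of_abs_le (h1 i _)) _
      _ ≤ c₁ * (opNorm (hessian g (coordMap u x)) *
            (c₁ * (c₁ * ‖gradient g (coordMap u y)‖ₑ))) := by
          gcongr
          refine (enorm_toEuclideanCLM_apply_le _ _).trans ?_
          gcongr
          refine (enorm_toLp_mul_le (fun i => enorm_le_of_abs_le (h1 i _)) _).trans ?_
          gcongr
          exact enorm_toLp_mul_le (fun i => enorm_le_of_abs_le (h1 i _)) _
      _ = _ := by ring

lemma hessGradBound_coordMap (hu : ∀ i, ContDiff ℝ 2 (u i))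
    (h1 : ∀ i x, |deriv (u i) x| ≤ c₁) (h2 : ∀ i x, |deriv (deriv (u i)) x| ≤ c₂)
    (hg : ContDiff ℝ 2 g) {K : ℝ≥0}
    (hK : (c₁ : ℝ≥0∞) * c₂ * kappa0 (gaussPi (Fin n)) (coordMap u) g + (c₁ : ℝ≥0∞) ^ 3 *
      kappa1 (gaussPi (Fin n)) (coordMap u) g * kappa2 (gaussPi (Fin n)) (coordMap u) g ≤ K) :
    HessGradBound (fun x => g (coordMap u x)) K := by
  intro v w hv hw
  have hU := contDiff_coordMap hu
  have hm : ∀ {f : (Fin n → ℝ) × (Fin n → ℝ) → (Fin n → ℝ)}, Measurable f → ∀ i,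
      Measurable fun p => ‖partialDeriv i g (coordMap u (f p))‖ₑ := fun hf i =>
    (((contDiff_partialDeriv hg i).continuous.comp hU.continuous).measurable.comp hf).enorm
  refine ((lintegral_mono fun p => sum_enorm_hessGrad_coordMap_le hu h1 h2 hg (v p) (w p)).trans
    (lintegral_add_sq_le ?_ ?_ (a := c₁ * c₂ * kappa0 (gaussPi (Fin n)) (coordMap u) g)
      (b := c₁ ^ 3 * (kappa1 (gaussPi (Fin n)) (coordMap u) g *
        kappa2 (gaussPi (Fin n)) (coordMap u) g)) ?_ ?_)).trans ?_
  · exact ((Finset.measurable_sum _ fun i _ => ((hm hv.measurable i).mul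
      (hm hw.measurable i)).pow_const 2).pow_const _).const_mul _
  · exact ((((continuous_opNorm_hessian hg).comp hU.continuous).measurable.comp
      hv.measurable).mul ((((continuous_gradient hg).comp hU.continuous).measurable.comp
        hw.measurable).enorm)).const_mul _
  · have e : ∀ a : ℝ≥0∞, (a ^ (1 / 2 : ℝ)) ^ 2 = a := fun a => by
      rw [← ENNReal.rpow_ofNat, ← ENNReal.rpow_mul]; norm_num
    simp only [mul_pow _ (_ ^ (1 / 2 : ℝ)), e]
    rw [lintegral_const_mul' _ _ (by finiteness), mul_pow _ (kappa0 _ _ _)]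
    gcongr
    exact lintegral_sum_sq_mul_sq_le hU hg hv hw
  · simp only [mul_pow ((c₁ : ℝ≥0∞) ^ 3)]
    rw [lintegral_const_mul' _ _ (by finiteness)]
    gcongr
    exact lintegral_opNorm_mul_gradient_le hU hg hv hw
  · rw [← mul_assoc]
    gcongr

end Product

/-! ### Gaussian vectors: linear maps. -/

section Linear

/-- The linear map with matrix `A`. -/
noncomputable def matrixMap (A : Matrix (Fin n) (Fin n) ℝ) (x : Fin n → ℝ) :
    EuclideanSpace ℝ (Fin n) :=
  Matrix.toEuclideanCLM (n := Fin n) (𝕜 := ℝ) A (WithLp.toLp 2 x)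

variable {A : Matrix (Fin n) (Fin n) ℝ} {g : EuclideanSpace ℝ (Fin n) → ℝ}

lemma contDiff_matrixMap (A : Matrix (Fin n) (Fin n) ℝ) : ContDiff ℝ 2 (matrixMap A) :=
  (ContinuousLinearMap.contDiff _).comp PiLp.contDiff_toLp

lemma pd_matrixMap (A : Matrix (Fin n) (Fin n) ℝ) (i k : Fin n) (x : Fin n → ℝ) :
    pd i (fun x => matrixMap A x k) x = A k i := by
  let L : (Fin n → ℝ) →L[ℝ] ℝ := LinearMap.toContinuousLinearMap
    ((LinearMap.proj k : (Fin n → ℝ) →ₗ[ℝ] ℝ) ∘ₗ Matrix.mulVecLin A)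
  have h : (fun x => matrixMap A x k) = L := by
    ext x
    simp [matrixMap, Matrix.toEuclideanCLM_toLp, L]
  rw [h, pd, L.fderiv]
  simp [L]

lemma pd_comp_matrixMap (hA : A.IsSymm) {f : EuclideanSpace ℝ (Fin n) → ℝ}
    (hf : ContDiff ℝ 1 f) (j : Fin n) (x : Fin n → ℝ) :
    pd j (fun x => f (matrixMap A x)) x = ∑ k, A j k * partialDeriv k f (matrixMap A x) := by
  rw [pd_comp ((contDiff_matrixMap A).of_le (by norm_num)) hf]
  simp only [pd_matrixMap, hA.apply]

lemma pd_pd_comp_matrixMap (hA : A.IsSymm) (hg : ContDiff ℝ 2 g) (i j : Fin n)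
    (x : Fin n → ℝ) :
    pd i (pd j fun x => g (matrixMap A x)) x = (A * hessian g (matrixMap A x) * A) i j := by
  have e : (pd j fun x => g (matrixMap A x)) =
      fun x => ∑ k, A j k * partialDeriv k g (matrixMap A x) :=
    funext fun x => pd_comp_matrixMap hA (hg.of_le (by norm_num)) j x
  have hd : ∀ k, DifferentiableAt ℝ (fun x => partialDeriv k g (matrixMap A x)) x := fun k =>
    ((contDiff_partialDeriv hg k).comp ((contDiff_matrixMap A).of_le (by norm_num))).differentiable
      one_ne_zero x
  have h3 : pd i (fun x => ∑ k, A j k * partialDeriv k g (matrixMap A x)) x =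
      ∑ k, A j k * pd i (fun x => partialDeriv k g (matrixMap A x)) x := by
    rw [pd, fderiv_fun_sum fun k _ => (hd k).const_mul _]
    simp only [sum_apply]
    refine Finset.sum_congr rfl fun k _ => ?_
    rw [fderiv_const_mul (hd k)]
    rfl
  rw [e, h3, Matrix.mul_apply]
  refine Finset.sum_congr rfl fun k _ => ?_
  rw [pd_comp_matrixMap hA (contDiff_partialDeriv hg k), Matrix.mul_apply, mul_comm, hA.apply]
  rfl

lemma hessGrad_comp_matrixMap (hA : A.IsSymm) (hg : ContDiff ℝ 2 g) (i : Fin n)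
    (x y : Fin n → ℝ) :
    hessGrad (fun x => g (matrixMap A x)) i x y =
      Matrix.toEuclideanCLM (n := Fin n) (𝕜 := ℝ) (A * hessian g (matrixMap A x) * A)
        (Matrix.toEuclideanCLM (n := Fin n) (𝕜 := ℝ) A (gradient g (matrixMap A y))) i := by
  rw [hessGrad, Matrix.ofLp_toEuclideanCLM, Matrix.ofLp_toEuclideanCLM]
  simp only [pd_pd_comp_matrixMap hA hg, pd_comp_matrixMap hA (hg.of_le (by norm_num) :
    ContDiff ℝ 1 g), Matrix.mulVec, dotProduct, gradient_apply]

lemma opNorm_mul_le (A B : Matrix (Fin n) (Fin n) ℝ) : opNorm (A * B) ≤ opNorm A * opNorm B := by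
  simp only [opNorm, map_mul, enorm_eq_nnnorm]
  exact_mod_cast nnnorm_mul_le (Matrix.toEuclideanCLM (n := Fin n) (𝕜 := ℝ) A)
    (Matrix.toEuclideanCLM (n := Fin n) (𝕜 := ℝ) B)

/-- The vector is `(A ∇²g A)(A ∇g)`, in which `A` occurs three times. -/
lemma hessGradBound_matrixMap (hA : A.IsSymm) (hg : ContDiff ℝ 2 g) {K : ℝ≥0}
    (hK : opNorm A ^ 3 * kappa1 (gaussPi (Fin n)) (matrixMap A) g *
      kappa2 (gaussPi (Fin n)) (matrixMap A) g ≤ K) :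
    HessGradBound (fun x => g (matrixMap A x)) K := by
  intro v w hv hw
  have hle : ∀ x y, ∑ i, ‖hessGrad (fun x => g (matrixMap A x)) i x y‖ₑ ^ 2 ≤
      (opNorm A ^ 3) ^ 2 *
        (opNorm (hessian g (matrixMap A x)) * ‖gradient g (matrixMap A y)‖ₑ) ^ 2 := by
    intro x y
    rw [← enorm_sq_toLp, ← mul_pow]
    refine pow_le_pow_left' ?_ 2
    simp only [hessGrad_comp_matrixMap hA hg]
    refine (enorm_toEuclideanCLM_apply_le _ _).trans ?_
    calc _ ≤ opNorm A * opNorm (hessian g (matrixMap A x)) * opNorm A *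
          (opNorm A * ‖gradient g (matrixMap A y)‖ₑ) := by
          gcongr
          · exact (opNorm_mul_le _ _).trans (mul_le_mul' (opNorm_mul_le _ _) le_rfl)
          · exact enorm_toEuclideanCLM_apply_le _ _
      _ = _ := by ring
  refine (lintegral_mono fun p => hle (v p) (w p)).trans ?_
  have hfin : opNorm A ≠ ⊤ := enorm_ne_top
  rw [lintegral_const_mul' _ _ (by finiteness)]
  refine (mul_le_mul' le_rfl
    (lintegral_opNorm_mul_gradient_le (contDiff_matrixMap A) hg hv hw)).trans ?_
  rw [← mul_pow, ← mul_assoc]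
  gcongr

end Linear

end

/-! ### Realization of the law of `X` as an image of a standard gaussian vector, and the two bounds.
-/

section

variable {n : ℕ}

lemma ne_top_or_eq_zero_of_mul_ne_top {c a b : ℝ≥0∞} (hc : c ≠ 0) (h : c * a * b ≠ ⊤) :
    a ≠ ⊤ ∨ b = 0 := by
  by_contra! hab
  refine h ?_
  rw [hab.1, ENNReal.mul_top hc, ENNReal.top_mul hab.2]

/-- Independence makes the law of `X` the product of its marginals, and an image of a product
measure under a coordinatewise map is a product of images. -/
lemma map_eq_map_coordMap {Ω : Type*} [MeasurableSpace Ω] {P : Measure Ω} [IsProbabilityMeasure P]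
    {X : Ω → EuclideanSpace ℝ (Fin n)} (hX : AEMeasurable X P)
    (hind : iIndepFun (fun (i : Fin n) (ω : Ω) => X ω i) P) {u : Fin n → ℝ → ℝ}
    (hu : ∀ i, Measurable (u i))
    (hlaw : ∀ i, P.map (fun ω => X ω i) = (gaussianReal 0 1).map (u i)) :
    P.map X = (gaussPi (Fin n)).map (coordMap u) := by
  have hXi : ∀ i, AEMeasurable (fun ω => X ω i) P := fun i =>
    (EuclideanSpace.proj i : StrongDual ℝ (EuclideanSpace ℝ (Fin n))).continuous.measurable
      |>.comp_aemeasurable hX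
  have h1 := (iIndepFun_iff_map_fun_eq_pi_map hXi).1 hind
  have hto : Measurable (WithLp.toLp 2 : (Fin n → ℝ) → EuclideanSpace ℝ (Fin n)) := by fun_prop
  have e1 : P.map X = (P.map fun ω i => X ω i).map (WithLp.toLp 2) := by
    rw [AEMeasurable.map_map_of_aemeasurable hto.aemeasurable (aemeasurable_pi_lambda _ hXi)]
    rfl
  have : ∀ i, IsProbabilityMeasure ((gaussianReal 0 1).map (u i)) := fun i =>
    Measure.isProbabilityMeasure_map (hu i).aemeasurable
  have hum : Measurable fun (x : Fin n → ℝ) i => u i (x i) :=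
    measurable_pi_lambda _ fun i => (hu i).comp (measurable_pi_apply i)
  rw [e1, h1]
  simp only [hlaw]
  rw [← Measure.pi_map_pi fun i => (hu i).aemeasurable, Measure.map_map hto hum]
  rfl

open scoped MatrixOrder in
lemma multivariateGaussian_zero_eq_map (S : Matrix (Fin n) (Fin n) ℝ) :
    multivariateGaussian 0 S = (gaussPi (Fin n)).map (matrixMap (CFC.sqrt S)) := by
  rw [multivariateGaussian, ← map_pi_eq_stdGaussian, Measure.map_map (by fun_prop) (by fun_prop)]
  congr 1
  ext1 x
  simp [matrixMap]

open scoped MatrixOrder in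
lemma isSymm_sqrt (S : Matrix (Fin n) (Fin n) ℝ) : (CFC.sqrt S).IsSymm :=
  (Matrix.conjTranspose_eq_transpose_of_trivial _).symm.trans (CFC.sqrt_nonneg S).isSelfAdjoint

-- The identity `‖T* T‖ = ‖T‖²` for `T = √S` gives `‖S‖ = ‖√S‖²`, which explains the exponent `3/2`.
open scoped MatrixOrder in
lemma opNorm_sqrt_pow_three {S : Matrix (Fin n) (Fin n) ℝ} (hS : S.PosSemidef) :
    opNorm (CFC.sqrt S) ^ 3 = opNorm S ^ (3 / 2 : ℝ) := by
  set T := Matrix.toEuclideanCLM (n := Fin n) (𝕜 := ℝ) (CFC.sqrt S)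
  have hT : IsSelfAdjoint T := (CFC.sqrt_nonneg S).isSelfAdjoint.map _
  have e : Matrix.toEuclideanCLM (n := Fin n) (𝕜 := ℝ) S = T.adjoint ∘L T := by
    rw [hT.adjoint_eq, ← ContinuousLinearMap.mul_def, ← map_mul,
      CFC.sqrt_mul_sqrt_self _ hS.nonneg]
  have h2 : opNorm S = opNorm (CFC.sqrt S) ^ 2 := by
    rw [opNorm, opNorm, e, ← ofReal_norm, ← ofReal_norm, ← ENNReal.ofReal_pow (norm_nonneg _),
      ContinuousLinearMap.norm_adjoint_comp_self, sq]
  rw [h2, ← ENNReal.rpow_ofNat, ← ENNReal.rpow_ofNat, ← ENNReal.rpow_mul]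
  norm_num

theorem dTV_le_of_gaussianImageClass {Ω Ω' : Type*} [MeasurableSpace Ω] [MeasurableSpace Ω']
    {P : Measure Ω} [IsProbabilityMeasure P] {P' : Measure Ω'}
    {X : Ω → EuclideanSpace ℝ (Fin n)} (hX : AEMeasurable X P)
    {g : EuclideanSpace ℝ (Fin n) → ℝ} (hg : ContDiff ℝ 2 g)
    (hW4 : MemLp (fun ω => g (X ω)) 4 P) {Z : Ω' → ℝ}
    (hZ : HasLaw Z (gaussianReal (∫ ω, g (X ω) ∂P) (Var[fun ω => g (X ω); P]).toNNReal) P')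
    {c₁ c₂ : ℝ≥0} (hind : iIndepFun (fun (i : Fin n) (ω : Ω) => X ω i) P)
    (hcl : ∀ i : Fin n, P.map (fun ω => X ω i) ∈ gaussianImageClass c₁ c₂) :
    dTV (fun ω => g (X ω)) P Z P' ≤
      2 * ENNReal.ofReal (Real.sqrt 5) *
        ((c₁ : ℝ≥0∞) * c₂ * kappa0 P X g + (c₁ : ℝ≥0∞) ^ 3 * kappa1 P X g * kappa2 P X g) /
          ENNReal.ofReal (Var[fun ω => g (X ω); P]) := by
  choose u hu h1 h2 hlaw using hcl
  have hU := contDiff_coordMap hu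
  have hmap := map_eq_map_coordMap hX hind (fun i => (hu i).continuous.measurable) hlaw
  have hUm : AEMeasurable (coordMap u) (gaussPi (Fin n)) := hU.continuous.aemeasurable
  rw [kappa0_congr hX hUm hmap hg, kappa1_congr hX hUm hmap hg, kappa2_congr hX hUm hmap hg]
  refine dTV_le_of_hessGradBound hX hg hW4 hZ hU hmap (fun hR i => ?_) fun hR =>
    hessGradBound_coordMap hu h1 h2 hg (ENNReal.coe_toNNReal hR).ge
  -- For `c₁ = 0` a finite bound says nothing about `κ₁` or `κ₂`, but then `g ∘ U` has vanishing
  -- derivatives.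
  rcases eq_or_ne c₁ 0 with rfl | hc
  · have : (pd i fun x => g (coordMap u x)) = fun _ => 0 := funext fun x => by
      rw [pd_comp_coordMap hu (hg.of_le (by norm_num)), abs_nonpos_iff.1 (h1 i _), zero_mul]
    rw [this]
    exact memLp_const _
  · refine memLp_pd_comp hU hg (C := c₁) (fun i k x => ?_)
      (ne_top_or_eq_zero_of_mul_ne_top (by simpa using hc) (ENNReal.add_ne_top.1 hR).2) i
    have := pd_comp_eval ((hu k).of_le (by norm_num : (1 : WithTop ℕ∞) ≤ 2)) i k x
    refine (congrArg norm this).trans_le ?_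
    split_ifs
    · exact h1 k _
    · simp

open scoped MatrixOrder in
theorem dTV_le_of_multivariateGaussian {Ω Ω' : Type*} [MeasurableSpace Ω] [MeasurableSpace Ω']
    {P : Measure Ω} [IsProbabilityMeasure P] {P' : Measure Ω'}
    {X : Ω → EuclideanSpace ℝ (Fin n)}
    {g : EuclideanSpace ℝ (Fin n) → ℝ} (hg : ContDiff ℝ 2 g)
    (hW4 : MemLp (fun ω => g (X ω)) 4 P) {Z : Ω' → ℝ}
    (hZ : HasLaw Z (gaussianReal (∫ ω, g (X ω) ∂P) (Var[fun ω => g (X ω); P]).toNNReal) P')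
    {S : Matrix (Fin n) (Fin n) ℝ} (hS : S.PosSemidef)
    (hX : HasLaw X (multivariateGaussian 0 S) P) :
    dTV (fun ω => g (X ω)) P Z P' ≤
      2 * ENNReal.ofReal (Real.sqrt 5) *
        (opNorm S ^ (3 / 2 : ℝ) * kappa1 P X g * kappa2 P X g) /
          ENNReal.ofReal (Var[fun ω => g (X ω); P]) := by
  set A := CFC.sqrt S
  have hU := contDiff_matrixMap A
  have hmap : P.map X = (gaussPi (Fin n)).map (matrixMap A) :=
    hX.map_eq.trans (multivariateGaussian_zero_eq_map S)
  have hUm : AEMeasurable (matrixMap A) (gaussPi (Fin n)) := hU.continuous.aemeasurable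
  have hXm := hX.aemeasurable
  have hAs : A.IsSymm := isSymm_sqrt S
  rw [kappa1_congr hXm hUm hmap hg, kappa2_congr hXm hUm hmap hg, ← opNorm_sqrt_pow_three hS]
  refine dTV_le_of_hessGradBound hXm hg hW4 hZ hU hmap (fun hR i => ?_) fun hR =>
    hessGradBound_matrixMap hAs hg (ENNReal.coe_toNNReal hR).ge
  -- As before, `A = 0` hides `κ₁` and `κ₂` behind a zero factor, and the derivatives of `g ∘ U`
  -- vanish.
  rcases eq_or_ne A 0 with h0 | h0
  · have : (pd i fun x => g (matrixMap A x)) = fun _ => 0 := funext fun x => by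
      rw [pd_comp_matrixMap hAs (hg.of_le (by norm_num)), h0]
      simp
    rw [this]
    exact memLp_const _
  -- Any common bound for the entries of `A` works, as it only serves integrability; the sum of
  -- their absolute values is one.
  · refine memLp_pd_comp hU hg (C := ∑ k, ∑ i, ‖A k i‖) (fun i k x => ?_)
      (ne_top_or_eq_zero_of_mul_ne_top
        (pow_ne_zero 3 fun h => h0 (eq_zero_of_opNorm_eq_zero h)) hR) i
    rw [pd_matrixMap]
    exact (Finset.single_le_sum (f := fun i => ‖A k i‖) (fun _ _ => norm_nonneg _)
      (Finset.mem_univ i)).trans (Finset.single_le_sum (f := fun k => ∑ i, ‖A k i‖)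
        (fun _ _ => Finset.sum_nonneg fun _ _ => norm_nonneg _) (Finset.mem_univ k))

end

end SecondOrderPoincare

theorem mainTheorem1 {Ω Ω' : Type*} [MeasurableSpace Ω] [MeasurableSpace Ω']
    (P : Measure Ω) [IsProbabilityMeasure P] (P' : Measure Ω') [IsProbabilityMeasure P']
    (n : ℕ) (X : Ω → EuclideanSpace ℝ (Fin n)) (hX : AEMeasurable X P)
    (g : EuclideanSpace ℝ (Fin n) → ℝ) (hg : ContDiff ℝ 2 g)
    (W : Ω → ℝ) (hW : W = fun ω => g (X ω)) (hW4 : MemLp W 4 P)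
    (Z : Ω' → ℝ) (hZ : HasLaw Z (gaussianReal (∫ ω, W ω ∂P) (variance W P).toNNReal) P') :
    (∀ c₁ c₂ : ℝ≥0,
      iIndepFun (fun (i : Fin n) (ω : Ω) => X ω i) P →
      (∀ i : Fin n, P.map (fun ω => X ω i) ∈ gaussianImageClass c₁ c₂) →
      dTV W P Z P' ≤
        2 * ENNReal.ofReal (Real.sqrt 5) *
            ((c₁ : ℝ≥0∞) * c₂ * kappa0 P X g + (c₁ : ℝ≥0∞) ^ 3 * kappa1 P X g * kappa2 P X g) /
          ENNReal.ofReal (variance W P)) ∧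
    (∀ S : Matrix (Fin n) (Fin n) ℝ, S.PosSemidef →
      HasLaw X (multivariateGaussian 0 S) P →
      dTV W P Z P' ≤
        2 * ENNReal.ofReal (Real.sqrt 5) *
            (opNorm S ^ (3 / 2 : ℝ) * kappa1 P X g * kappa2 P X g) /
          ENNReal.ofReal (variance W P)) := by
  subst hW
  exact ⟨fun c₁ c₂ hind hcl => dTV_le_of_gaussianImageClass hX hg hW4 hZ hind hcl,
    fun S hS hXS => dTV_le_of_multivariateGaussian hg hW4 hZ hS hXS⟩
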